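/- Let $0<q<2$ and let $(\rho_j)_{j\in\mathbb N}$ be an increasing (i.e. nondecreasing) sequence of numbers strictly larger than $1$ with $(\rho_j^{-1})_{j}\in\ell_q(\mathbb N)$. For finitely supported multi-indices $s=(s_j)_{j\in\mathbb N}$ of nonnegative integers put $\sigma_s:=\prod_j\rho_j^{s_j}$, and for $\xi>0$ put $\Lambda(\xi):=\{s:\sigma_s^q\le\xi\}$. A ReLU network $\Phi$ here is a feed-forward network in which a layer may be connected with all preceding layers (activation $\max\{t,0\}$ in the hidden layers, none in the output layer); its depth $L(\Phi)$ is the number of layers, the input not counted, its size $W(\Phi)$ is the number of its nonzero weights and biases, and it is called deep if $L(\Phi)\ge 3$. Then there are positive constants $K,C_0,c_1,c_2$ and, for every integer $n>1$, a number $\xi_n$ with $c_1\frac{n}{\log n}\le\xi_n\le c_2\frac{n}{\log n}$ and a deep ReLU network $\phi_{\Lambda(\xi_n)}=(\phi_s)_{s\in\Lambda(\xi_n)}$ on $\mathbb R^m$, $m:=\lfloor K\frac{n}{\log n}\rfloor$, all depending only on $q$, $(\rho_j)$ and (for $\xi_n$, $m$ and the network) $n$, such that: (i) the input dimension is $m$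 and the output dimension $|\Lambda(\xi_n)|$ is at most $m$; (ii) $W(\phi_{\Lambda(\xi_n)})\le n$; (iii) $L(\phi_{\Lambda(\xi_n)})\le C_0\,\log n\,\log\log n$ if $n>2$; (iv) for every bounded open set $D\subset\mathbb R^d$, $d\ge1$ (for instance a bounded Lipschitz domain), every $\alpha>0$ and every $\theta<1$ there is a constant $C>0$ such that the following holds for all $n>1$. Let $V:=H^1_0(D)$, normed by the $H^1(D)$ norm, let $f\in H^{-1}(D)=V'$, $\bar a\in L_\infty(D)$ with $\operatorname{ess\,inf}\bar a\ge\alpha$, and $\psi_j\in L_\infty(D)$ ($j\in\mathbb N$) with $$\Big\|\frac{\sum_{j}\rho_j|\psi_j|}{\bar a}\Big\|_{L_\infty(D)}\le\theta .$$ For $y\in[-1,1]^\infty$ let $u(y)\in V$ be the weak solution of $-\operatorname{div}(a(y)\nabla u(y))=f$ in $D$, $u(y)|_{\partial D}=0$, where $a(y)=\bar a+\sum_j y_j\psi_j$, and let $t_s:=\frac1{s!}\partial^s u(0)\in V$ be the Taylor coefficients of $u$. Then $$\sup_{y\in[-1,1]^\infty}\Big\|u(y)-\sum_{s\in\Lambda(\xi_n)}t_s\,\phi_s(y_1,\dots,y_m)\Big\|_V\le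 C\,\|f\|_{V'}\Big(\frac{n}{\log n}\Big)^{-(1/q-1/2)} .$$ In particular the network does not depend on $u$ (that is, on $D,\bar a,(\psi_j),f$), and $K$, $C_0$, $C$ do not depend on $n$. -/

import Mathlib

open MeasureTheory
open scoped ENNReal ContDiff

noncomputable section

/-! ### ReLU networks with connections from every preceding layer -/

/-- A feed-forward ReLU network in which every layer is connected with all preceding layers.
Layer `0` is the input, the layers `1, …, hiddenLayers` are hidden, and the layer
`hiddenLayers + 1` is the output. `weight ℓ` and `bias ℓ` are the matrix and the vector that
produce layer `ℓ + 1` from the layers `0, …, ℓ`; their values for `ℓ > hiddenLayers` (and those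
of `width ℓ` for `ℓ > hiddenLayers + 1`) are never used. -/
structure ReLUNetwork where
  hiddenLayers : ℕ
  one_le_hiddenLayers : 1 ≤ hiddenLayers
  width : ℕ → ℕ
  width_pos : ∀ ℓ, ℓ ≤ hiddenLayers + 1 → 0 < width ℓ
  weight : (ℓ : ℕ) → Matrix (Fin (width (ℓ + 1))) (Σ i : Fin (ℓ + 1), Fin (width i)) ℝ
  bias : (ℓ : ℕ) → Fin (width (ℓ + 1)) → ℝ

namespace ReLUNetwork

/-- Input dimension. -/
def inDim (Φ : ReLUNetwork) : ℕ := Φ.width 0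

/-- Output dimension. -/
def outDim (Φ : ReLUNetwork) : ℕ := Φ.width (Φ.hiddenLayers + 1)

/-- The depth `L(Φ)`: the number of layers, the input not counted. -/
def depth (Φ : ReLUNetwork) : ℕ := Φ.hiddenLayers + 1

/-- The size `W(Φ)`: the number of nonzero weights and nonzero biases. -/
def size (Φ : ReLUNetwork) : ℕ :=
  ∑ ℓ ∈ Finset.range Φ.depth,
    (Nat.card {p : Fin (Φ.width (ℓ + 1)) × (Σ i : Fin (ℓ + 1), Fin (Φ.width i)) //
        Φ.weight ℓ p.1 p.2 ≠ 0} +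
      Nat.card {k : Fin (Φ.width (ℓ + 1)) // Φ.bias ℓ k ≠ 0})

/-- The values of the neurons of layer `ℓ` (the input for `ℓ = 0`, a hidden layer otherwise). -/
def neurons (Φ : ReLUNetwork) (x : Fin (Φ.width 0) → ℝ) : (ℓ : ℕ) → Fin (Φ.width ℓ) → ℝ
  | 0 => x
  | ℓ + 1 => fun k =>
      max ((∑ p : (Σ i : Fin (ℓ + 1), Fin (Φ.width i)),
        Φ.weight ℓ k p * Φ.neurons x p.1 p.2) + Φ.bias ℓ k) 0
termination_by ℓ => ℓ
decreasing_by exact p.1.isLt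

/-- The output of the network; no activation is applied in the last layer. -/
def realize (Φ : ReLUNetwork) (x : Fin Φ.inDim → ℝ) : Fin Φ.outDim → ℝ := fun k =>
  (∑ p : (Σ i : Fin (Φ.hiddenLayers + 1), Fin (Φ.width i)),
    Φ.weight Φ.hiddenLayers k p * Φ.neurons x p.1 p.2) + Φ.bias Φ.hiddenLayers k

end ReLUNetwork

/-! ### Multi-indices and Taylor coefficients -/

/-- `σ_s = ∏_j ρ_j ^ s_j` for a finitely supported multi-index `s`. -/
def sigmaWeight (ρ : ℕ → ℝ) (s : ℕ →₀ ℕ) : ℝ := s.prod fun j k => ρ j ^ k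

/-- `Λ(ξ) = {s : σ_s ^ q ≤ ξ}`. -/
def LambdaSet (q : ℝ) (ρ : ℕ → ℝ) (ξ : ℝ) : Set (ℕ →₀ ℕ) := {s | sigmaWeight ρ s ^ q ≤ ξ}

/-- The partial derivative with respect to the `j`-th parameter. -/
def partialDeriv {X : Type*} [NormedAddCommGroup X] [NormedSpace ℝ X] (j : ℕ)
    (g : (ℕ → ℝ) → X) : (ℕ → ℝ) → X :=
  fun y => deriv (fun t : ℝ => g (Function.update y j t)) (y j)

/-- The mixed partial derivative `∂^s g`, taken `s_j` times in the `j`-th parameter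
for every `j` in the support of `s`. -/
def mixedPartial {X : Type*} [NormedAddCommGroup X] [NormedSpace ℝ X] (s : ℕ →₀ ℕ)
    (g : (ℕ → ℝ) → X) : (ℕ → ℝ) → X :=
  (s.support.sort (· ≤ ·)).foldr (fun j h => (partialDeriv j)^[s j] h) g

/-- The Taylor coefficient `t_s = ∂^s g (0) / s!`. -/
def taylorCoeff {X : Type*} [NormedAddCommGroup X] [NormedSpace ℝ X]
    (g : (ℕ → ℝ) → X) (s : ℕ →₀ ℕ) : X :=
  (s.prod fun _ k => (Nat.factorial k : ℝ))⁻¹ • mixedPartial s g 0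

/-! ### The space `H^1_0(D)` and weak solutions -/

/-- The Hilbert space `L_2(D) × L_2(D; ℝ^d)`, in which a Sobolev function is represented by the
pair of itself and its weak gradient; the norm of such a pair is the `H^1(D)` norm. -/
abbrev GradPair {d : ℕ} (D : Set (EuclideanSpace ℝ (Fin d))) : Type :=
  WithLp 2 (Lp ℝ 2 (volume.restrict D) × Lp (EuclideanSpace ℝ (Fin d)) 2 (volume.restrict D))

/-- The pairs `(φ, ∇φ)` for `φ ∈ C_c^∞(D)`. -/
def testPairs {d : ℕ} (D : Set (EuclideanSpace ℝ (Fin d))) : Set (GradPair D) :=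
  {p | ∃ φ : EuclideanSpace ℝ (Fin d) → ℝ,
    ContDiff ℝ ∞ φ ∧ HasCompactSupport φ ∧ tsupport φ ⊆ D ∧
    (p.fst : EuclideanSpace ℝ (Fin d) → ℝ) =ᵐ[volume.restrict D] φ ∧
    (p.snd : EuclideanSpace ℝ (Fin d) → EuclideanSpace ℝ (Fin d))
      =ᵐ[volume.restrict D] fun x => gradient φ x}

/-- `H^1_0(D)`, the closure of `C_c^∞(D)` in the `H^1(D)` norm. -/
abbrev H10 {d : ℕ} (D : Set (EuclideanSpace ℝ (Fin d))) : Submodule ℝ (GradPair D) :=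
  (Submodule.span ℝ (testPairs D)).topologicalClosure

/-- The weak gradient of an element of `H^1_0(D)`. -/
def weakGrad {d : ℕ} {D : Set (EuclideanSpace ℝ (Fin d))} (v : H10 D) :
    Lp (EuclideanSpace ℝ (Fin d)) 2 (volume.restrict D) :=
  (v : GradPair D).snd

/-- `w ∈ H^1_0(D)` solves `-div(a ∇w) = f` in `D`, `w = 0` on `∂D`, in the weak sense. -/
def IsWeakSolution {d : ℕ} {D : Set (EuclideanSpace ℝ (Fin d))}
    (a : EuclideanSpace ℝ (Fin d) → ℝ) (f : H10 D →L[ℝ] ℝ) (w : H10 D) : Prop :=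
  ∀ v : H10 D, ∫ x in D, a x * inner ℝ (weakGrad w x) (weakGrad v x) = f v

/-- The affine diffusion coefficient `a(y) = ā + ∑_j y_j ψ_j`. -/
def affineCoeff {E : Type*} (abar : E → ℝ) (ψ : ℕ → E → ℝ) (y : ℕ → ℝ) (x : E) : ℝ :=
  abar x + ∑' j, y j * ψ j x

/-- The parameter domain `[-1,1]^∞`. -/
def paramCube : Set (ℕ → ℝ) := {y | ∀ j, |y j| ≤ 1}

end

theorem sigmaWeight_zero (y : ℕ → ℝ) : sigmaWeight y 0 = 1 := by
  simp [sigmaWeight]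

theorem sigmaWeight_add (y : ℕ → ℝ) (s t : ℕ →₀ ℕ) :
    sigmaWeight y (s + t) = sigmaWeight y s * sigmaWeight y t :=
  Finsupp.prod_add_index' (by simp) (by intros; exact pow_add _ _ _)

theorem sigmaWeight_single (y : ℕ → ℝ) (j k : ℕ) :
    sigmaWeight y (Finsupp.single j k) = y j ^ k := by
  simp [sigmaWeight]

theorem sigmaWeight_eq_prod_of_support_subset (y : ℕ → ℝ) (s : ℕ →₀ ℕ) {F : Finset ℕ}
    (h : s.support ⊆ F) : sigmaWeight y s = ∏ j ∈ F, y j ^ s j :=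
  Finsupp.prod_of_support_subset _ h _ (by simp)

theorem sigmaWeight_mul (x y : ℕ → ℝ) (s : ℕ →₀ ℕ) :
    sigmaWeight (fun j => x j * y j) s = sigmaWeight x s * sigmaWeight y s := by
  simp [sigmaWeight, Finsupp.prod, mul_pow, Finset.prod_mul_distrib]

theorem sigmaWeight_inv (y : ℕ → ℝ) (s : ℕ →₀ ℕ) :
    sigmaWeight (fun j => (y j)⁻¹) s = (sigmaWeight y s)⁻¹ := by
  simp [sigmaWeight, Finsupp.prod]

theorem abs_sigmaWeight (y : ℕ → ℝ) (s : ℕ →₀ ℕ) :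
    |sigmaWeight y s| = sigmaWeight (fun j => |y j|) s := by
  simp [sigmaWeight, Finsupp.prod, Finset.abs_prod]

theorem sigmaWeight_nonneg {y : ℕ → ℝ} (hy : ∀ j, 0 ≤ y j) (s : ℕ →₀ ℕ) :
    0 ≤ sigmaWeight y s :=
  Finset.prod_nonneg fun j _ => pow_nonneg (hy j) _

theorem sigmaWeight_pos {y : ℕ → ℝ} (hy : ∀ j, 0 < y j) (s : ℕ →₀ ℕ) :
    0 < sigmaWeight y s :=
  Finset.prod_pos fun j _ => pow_pos (hy j) _

theorem one_le_sigmaWeight {y : ℕ → ℝ} (hy : ∀ j, 1 ≤ y j) (s : ℕ →₀ ℕ) :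
    1 ≤ sigmaWeight y s :=
  Finset.prod_induction _ (1 ≤ ·) (fun _ _ => one_le_mul_of_one_le_of_one_le) le_rfl
    fun j _ => one_le_pow₀ (hy j)

theorem sigmaWeight_mono_base {x y : ℕ → ℝ} (hx : ∀ j, 0 ≤ x j) (hxy : ∀ j, x j ≤ y j)
    (s : ℕ →₀ ℕ) : sigmaWeight x s ≤ sigmaWeight y s :=
  Finset.prod_le_prod (fun j _ => pow_nonneg (hx j) _)
    fun j _ => pow_le_pow_left₀ (hx j) (hxy j) _

theorem abs_sigmaWeight_le_one {y : ℕ → ℝ} (hy : ∀ j, |y j| ≤ 1) (s : ℕ →₀ ℕ) :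
    |sigmaWeight y s| ≤ 1 := by
  rw [abs_sigmaWeight]
  exact Finset.prod_le_one (fun j _ => pow_nonneg (abs_nonneg _) _)
    fun j _ => pow_le_one₀ (abs_nonneg _) (hy j)

theorem sigmaWeight_rpow {y : ℕ → ℝ} (hy : ∀ j, 0 ≤ y j) (q : ℝ) (s : ℕ →₀ ℕ) :
    sigmaWeight (fun j => y j ^ q) s = sigmaWeight y s ^ q := by
  unfold sigmaWeight Finsupp.prod
  rw [← Real.finsetProd_rpow _ _ fun j _ => pow_nonneg (hy j) _]
  refine Finset.prod_congr rfl fun j _ => ?_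
  change (y j ^ q) ^ s j = (y j ^ s j) ^ q
  rw [← Real.rpow_natCast, ← Real.rpow_natCast, ← Real.rpow_mul (hy j), ← Real.rpow_mul (hy j),
    mul_comm]

/-- `∑_s x^s ≤ ∏_j (1 - x_j)⁻¹`, in summability form. -/
theorem summable_sigmaWeight {x : ℕ → ℝ} {c : ℝ} (hc : c < 1) (hx0 : ∀ j, 0 ≤ x j)
    (hxc : ∀ j, x j ≤ c) (hx : Summable x) : Summable (sigmaWeight x) := by
  have hc' : 0 < 1 - c := by linarith
  refine summable_of_sum_le (c := Real.exp (∑' j, x j / (1 - c)))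
    (fun s => sigmaWeight_nonneg hx0 s) fun F => ?_
  obtain ⟨J, hJ⟩ : ∃ J, ∀ s ∈ F, s.support ⊆ Finset.range J := by
    obtain ⟨J, hJ⟩ := (F.biUnion fun s => s.support).exists_nat_subset_range
    exact ⟨J, fun s hs => (Finset.subset_biUnion_of_mem (fun s : ℕ →₀ ℕ => s.support) hs).trans hJ⟩
  obtain ⟨N, hN⟩ : ∃ N, ∀ s ∈ F, ∀ j, s j < N := by
    refine ⟨(F.sup fun s => s.degree) + 1, fun s hs j => Nat.lt_succ_of_le ?_⟩
    exact (Finsupp.le_degree j s).trans (Finset.le_sup (f := fun s : ℕ →₀ ℕ => s.degree) hs)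
  have hinj : Set.InjOn (fun (s : ℕ →₀ ℕ) (i : Fin J) => s i) (F : Set (ℕ →₀ ℕ)) := by
    intro s hs t ht hst
    ext j
    by_cases hj : j < J
    · exact congrFun hst ⟨j, hj⟩
    · rw [Finsupp.notMem_support_iff.1 fun h => hj (Finset.mem_range.1 (hJ s hs h)),
        Finsupp.notMem_support_iff.1 fun h => hj (Finset.mem_range.1 (hJ t ht h))]
  calc ∑ s ∈ F, sigmaWeight x s = ∑ s ∈ F, ∏ i : Fin J, x i ^ s i := by
        refine Finset.sum_congr rfl fun s hs => ?_
        rw [sigmaWeight_eq_prod_of_support_subset x s (hJ s hs),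
          Finset.prod_range (fun j => x j ^ s j)]
    _ = ∑ p ∈ F.image (fun (s : ℕ →₀ ℕ) (i : Fin J) => s i), ∏ i : Fin J, x i ^ p i := by
        rw [Finset.sum_image hinj]
    _ ≤ ∑ p ∈ Fintype.piFinset fun _ : Fin J => Finset.range N, ∏ i : Fin J, x i ^ p i := by
        refine Finset.sum_le_sum_of_subset_of_nonneg ?_ fun p _ _ =>
          Finset.prod_nonneg fun i _ => pow_nonneg (hx0 i) _
        intro p hp
        obtain ⟨s, hs, rfl⟩ := Finset.mem_image.1 hp
        exact Fintype.mem_piFinset.2 fun i => Finset.mem_range.2 (hN s hs i)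
    _ = ∏ i : Fin J, ∑ k ∈ Finset.range N, x i ^ k :=
        (Finset.prod_univ_sum (fun _ : Fin J => Finset.range N) (fun i k => x i ^ k)).symm
    _ ≤ ∏ i : Fin J, Real.exp (x i / (1 - c)) := by
        refine Finset.prod_le_prod
          (fun i _ => Finset.sum_nonneg fun k _ => pow_nonneg (hx0 i) _) fun i _ => ?_
        have h1 : x i < 1 := (hxc i).trans_lt hc
        have h2 : ∑ k ∈ Finset.range N, x i ^ k ≤ (1 - x i)⁻¹ := by
          rw [← tsum_geometric_of_lt_one (hx0 i) h1]
          exact (summable_geometric_of_lt_one (hx0 i) h1).sum_le_tsum _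
            fun k _ => pow_nonneg (hx0 i) _
        have h3 : (1 - x i)⁻¹ ≤ x i / (1 - c) + 1 := by
          rw [inv_eq_one_div, div_le_iff₀ (by linarith)]
          have h4 : x i * (1 - c) ≤ x i * (1 - x i) :=
            mul_le_mul_of_nonneg_left (by linarith [hxc i]) (hx0 i)
          have h5 : x i ≤ x i / (1 - c) * (1 - x i) := by
            rw [div_mul_eq_mul_div, le_div_iff₀ hc']; exact h4
          linarith
        exact h2.trans (h3.trans (Real.add_one_le_exp _))
    _ = Real.exp (∑ j ∈ Finset.range J, x j / (1 - c)) := by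
        rw [← Real.exp_sum, Finset.sum_range fun j => x j / (1 - c)]
    _ ≤ Real.exp (∑' j, x j / (1 - c)) :=
        Real.exp_le_exp.2 ((hx.div_const _).sum_le_tsum _
          fun j _ => div_nonneg (hx0 j) hc'.le)

section Weights

variable {q : ℝ} {ρ : ℕ → ℝ}

theorem summable_sigmaWeight_rpow_neg (hq0 : 0 < q) (hρ_one : ∀ j, 1 < ρ j) (hρ_mono : Monotone ρ)
    (hρ_sum : Summable fun j => (ρ j)⁻¹ ^ q) :
    Summable fun s => (sigmaWeight ρ s ^ q)⁻¹ := by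
  have hpos : ∀ j, 0 < ρ j := fun j => zero_lt_one.trans (hρ_one j)
  have hinv : ∀ j, 0 ≤ (ρ j)⁻¹ := fun j => (inv_pos.2 (hpos j)).le
  have key := summable_sigmaWeight (x := fun j => (ρ j)⁻¹ ^ q) (c := (ρ 0)⁻¹ ^ q)
    (Real.rpow_lt_one (hinv 0) (inv_lt_one_of_one_lt₀ (hρ_one 0)) hq0)
    (fun j => Real.rpow_nonneg (hinv j) q)
    (fun j => Real.rpow_le_rpow (hinv j)
      (inv_anti₀ (hpos 0) (hρ_mono (Nat.zero_le j))) hq0.le) hρ_sum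
  refine key.congr fun s => ?_
  rw [sigmaWeight_rpow hinv, sigmaWeight_inv,
    Real.inv_rpow (sigmaWeight_nonneg (fun j => (hpos j).le) s)]

theorem LambdaSet_card_le (hρ_one : ∀ j, 1 < ρ j)
    (hs : Summable fun s => (sigmaWeight ρ s ^ q)⁻¹) {ξ : ℝ} (hξ : 0 < ξ)
    {F : Finset (ℕ →₀ ℕ)} (hF : ∀ s ∈ F, s ∈ LambdaSet q ρ ξ) :
    (F.card : ℝ) ≤ (∑' s, (sigmaWeight ρ s ^ q)⁻¹) * ξ := by
  have hpos : ∀ s, 0 < sigmaWeight ρ s ^ q := fun s =>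
    Real.rpow_pos_of_pos (sigmaWeight_pos (fun j => zero_lt_one.trans (hρ_one j)) s) q
  have h1 : (F.card : ℝ) * ξ⁻¹ ≤ ∑ s ∈ F, (sigmaWeight ρ s ^ q)⁻¹ := by
    rw [← nsmul_eq_mul]
    exact Finset.card_nsmul_le_sum _ _ _ fun s hsF => inv_anti₀ (hpos s) (hF s hsF)
  have h2 := hs.sum_le_tsum F fun s _ => (inv_pos.2 (hpos s)).le
  have h3 := h1.trans h2
  rwa [← div_eq_mul_inv, div_le_iff₀ hξ] at h3

theorem LambdaSet_finite (hρ_one : ∀ j, 1 < ρ j)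
    (hs : Summable fun s => (sigmaWeight ρ s ^ q)⁻¹) {ξ : ℝ} (hξ : 0 < ξ) :
    (LambdaSet q ρ ξ).Finite := by
  by_contra h
  obtain ⟨F, hF, hcard⟩ := Set.Infinite.exists_subset_card_eq h
    (⌊(∑' s, (sigmaWeight ρ s ^ q)⁻¹) * ξ⌋₊ + 1)
  have h1 := LambdaSet_card_le hρ_one hs hξ (F := F) fun s hsF => hF hsF
  have h2 := Nat.lt_floor_add_one ((∑' s, (sigmaWeight ρ s ^ q)⁻¹) * ξ)
  rw [hcard] at h1
  push_cast at h1
  linarith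

theorem sigmaWeight_mono (hρ_one : ∀ j, 1 < ρ j) {s t : ℕ →₀ ℕ} (hst : s ≤ t) :
    sigmaWeight ρ s ≤ sigmaWeight ρ t := by
  obtain ⟨r, rfl⟩ := le_iff_exists_add.1 hst
  rw [sigmaWeight_add]
  exact le_mul_of_one_le_right
    (sigmaWeight_nonneg (fun j => (zero_lt_one.trans (hρ_one j)).le) s)
    (one_le_sigmaWeight (fun j => (hρ_one j).le) r)

theorem LambdaSet_of_sigmaWeight_le (hq0 : 0 < q) (hρ_one : ∀ j, 1 < ρ j) {ξ : ℝ}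
    {s t : ℕ →₀ ℕ} (hst : sigmaWeight ρ s ≤ sigmaWeight ρ t) (ht : t ∈ LambdaSet q ρ ξ) :
    s ∈ LambdaSet q ρ ξ :=
  (Real.rpow_le_rpow (sigmaWeight_nonneg (fun j => (zero_lt_one.trans (hρ_one j)).le) s)
    hst hq0.le).trans ht

theorem zero_mem_LambdaSet {ξ : ℝ} (hξ : 1 ≤ ξ) : (0 : ℕ →₀ ℕ) ∈ LambdaSet q ρ ξ := by
  simpa [LambdaSet, sigmaWeight_zero] using hξ

theorem pow_degree_le_sigmaWeight (hρ_one : ∀ j, 1 < ρ j) (hρ_mono : Monotone ρ) (s : ℕ →₀ ℕ) :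
    ρ 0 ^ s.degree ≤ sigmaWeight ρ s := by
  have h : sigmaWeight (fun _ => ρ 0) s = ρ 0 ^ s.degree := by
    simp [sigmaWeight, Finsupp.prod, Finset.prod_pow_eq_pow_sum, Finsupp.degree_apply]
  rw [← h]
  exact sigmaWeight_mono_base (fun _ => (zero_lt_one.trans (hρ_one 0)).le)
    (fun j => hρ_mono (Nat.zero_le j)) s

theorem degree_mul_le_log (hq0 : 0 < q) (hρ_one : ∀ j, 1 < ρ j) (hρ_mono : Monotone ρ)
    {ξ : ℝ} {s : ℕ →₀ ℕ} (hs : s ∈ LambdaSet q ρ ξ) :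
    (s.degree : ℝ) * (q * Real.log (ρ 0)) ≤ Real.log ξ := by
  have h0 : 0 < ρ 0 := zero_lt_one.trans (hρ_one 0)
  have h1 : (ρ 0 ^ s.degree) ^ q ≤ ξ :=
    (Real.rpow_le_rpow (pow_nonneg h0.le _) (pow_degree_le_sigmaWeight hρ_one hρ_mono s)
      hq0.le).trans hs
  have h2 := Real.log_le_log (Real.rpow_pos_of_pos (pow_pos h0 _) q) h1
  rw [Real.log_rpow (pow_pos h0 _), Real.log_pow] at h2
  linarith

theorem eq_zero_of_mem_LambdaSet_one (hq0 : 0 < q) (hρ_one : ∀ j, 1 < ρ j)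
    (hρ_mono : Monotone ρ) {s : ℕ →₀ ℕ} (hs : s ∈ LambdaSet q ρ 1) : s = 0 := by
  have h := degree_mul_le_log hq0 hρ_one hρ_mono hs
  rw [Real.log_one] at h
  have hl : 0 < q * Real.log (ρ 0) := mul_pos hq0 (Real.log_pos (hρ_one 0))
  have h2 : (s.degree : ℝ) ≤ 0 := by
    by_contra hc
    exact absurd h (not_le.2 (mul_pos (not_le.1 hc) hl))
  have h3 : s.degree = 0 := by exact_mod_cast le_antisymm h2 (Nat.cast_nonneg _)
  exact (Finsupp.degree_eq_zero_iff s).1 h3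

theorem index_lt_card (hq0 : 0 < q) (hρ_one : ∀ j, 1 < ρ j) (hρ_mono : Monotone ρ)
    {ξ : ℝ} {F : Finset (ℕ →₀ ℕ)} (hF : ∀ s, s ∈ F ↔ s ∈ LambdaSet q ρ ξ)
    {s : ℕ →₀ ℕ} (hs : s ∈ F) {j : ℕ} (hj : s j ≠ 0) : j < F.card := by
  have hsub : (Finset.range (j + 1)).image (fun i => Finsupp.single i 1) ⊆ F := by
    intro t ht
    obtain ⟨i, hi, rfl⟩ := Finset.mem_image.1 ht
    refine (hF _).2 (LambdaSet_of_sigmaWeight_le hq0 hρ_one (t := s) ?_ ((hF s).1 hs))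
    refine le_trans ?_ (sigmaWeight_mono hρ_one (s := Finsupp.single j 1) (t := s) ?_)
    · rw [sigmaWeight_single, sigmaWeight_single, pow_one, pow_one]
      exact hρ_mono (Nat.lt_succ_iff.1 (Finset.mem_range.1 hi))
    · exact Finsupp.single_le_iff.2 (Nat.one_le_iff_ne_zero.2 hj)
  have hcard := Finset.card_le_card hsub
  rw [Finset.card_image_of_injective _ (Finsupp.single_left_injective one_ne_zero),
    Finset.card_range] at hcard
  omega

theorem sigmaWeight_sq_inv_le (hq2 : q < 2) (hρ_one : ∀ j, 1 < ρ j) (s : ℕ →₀ ℕ) :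
    (sigmaWeight ρ s ^ 2)⁻¹ ≤ (sigmaWeight ρ s ^ q)⁻¹ := by
  have h1 := one_le_sigmaWeight (fun j => (hρ_one j).le) s
  refine inv_anti₀ (Real.rpow_pos_of_pos (by linarith) q) ?_
  rw [← Real.rpow_natCast]
  exact Real.rpow_le_rpow_of_exponent_le h1 (by norm_num; exact hq2.le)

theorem sigmaWeight_sq_inv_le_of_notMem (hq0 : 0 < q) (hq2 : q < 2) (hρ_one : ∀ j, 1 < ρ j)
    {ξ : ℝ} (hξ : 0 < ξ) {s : ℕ →₀ ℕ} (hs : s ∉ LambdaSet q ρ ξ) :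
    (sigmaWeight ρ s ^ 2)⁻¹ ≤ (sigmaWeight ρ s ^ q)⁻¹ * ξ ^ (-(2 / q - 1)) := by
  have h1 : 0 < sigmaWeight ρ s := sigmaWeight_pos (fun j => zero_lt_one.trans (hρ_one j)) s
  have h2 : ξ < sigmaWeight ρ s ^ q := not_le.1 hs
  have h3 : 0 < 2 / q - 1 := by
    rw [sub_pos, lt_div_iff₀ hq0]; linarith
  have h4 : sigmaWeight ρ s ^ 2
      = sigmaWeight ρ s ^ q * (sigmaWeight ρ s ^ q) ^ (2 / q - 1) := by
    rw [← Real.rpow_mul h1.le, ← Real.rpow_add h1, ← Real.rpow_natCast]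
    congr 1
    field_simp
    norm_num
  rw [h4, mul_inv, Real.rpow_neg hξ.le]
  refine mul_le_mul_of_nonneg_left ?_ (inv_nonneg.2 (Real.rpow_nonneg h1.le _))
  exact inv_anti₀ (Real.rpow_pos_of_pos hξ _) (Real.rpow_le_rpow hξ.le h2.le h3.le)

end Weights

section Recursion

variable {V : Type*} [NormedAddCommGroup V] [InnerProductSpace ℝ V]

/-- `τ` are the Taylor coefficients of the solution of
`a(u, w) + ∑_j y_j B_j(u, w) = f(w)`. -/
structure IsTaylorRecursion (a : V →L[ℝ] V →L[ℝ] ℝ) (B : ℕ → V →L[ℝ] V →L[ℝ] ℝ)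
    (f : V →L[ℝ] ℝ) (τ : (ℕ →₀ ℕ) → V) : Prop where
  zero : ∀ w, a (τ 0) w = f w
  succ : ∀ s, s ≠ 0 → ∀ w, a (τ s) w
    = -∑ j ∈ s.support, B j (τ (s - Finsupp.single j 1)) w

theorem IsCoercive.exists_forall_apply_eq [CompleteSpace V] {a : V →L[ℝ] V →L[ℝ] ℝ}
    (ha : IsCoercive a) (g : V →L[ℝ] ℝ) : ∃ v, ∀ w, a v w = g w := by
  refine ⟨ha.continuousLinearEquivOfBilin.symm ((InnerProductSpace.toDual ℝ V).symm g),
    fun w => ?_⟩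
  rw [← ha.continuousLinearEquivOfBilin_apply, ContinuousLinearEquiv.apply_symm_apply,
    InnerProductSpace.toDual_symm_apply]

theorem degree_sub_single_add_one {s : ℕ →₀ ℕ} {j : ℕ} (hj : j ∈ s.support) :
    (s - Finsupp.single j 1).degree + 1 = s.degree := by
  have h : s - Finsupp.single j 1 + Finsupp.single j 1 = s :=
    tsub_add_cancel_of_le
      (Finsupp.single_le_iff.2 (Nat.one_le_iff_ne_zero.2 (Finsupp.mem_support_iff.1 hj)))
  conv_rhs => rw [← h]
  simp

theorem exists_isTaylorRecursion [CompleteSpace V] {a : V →L[ℝ] V →L[ℝ] ℝ} (ha : IsCoercive a)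
    (B : ℕ → V →L[ℝ] V →L[ℝ] ℝ) (f : V →L[ℝ] ℝ) : ∃ τ, IsTaylorRecursion a B f τ := by
  choose sol hsol using ha.exists_forall_apply_eq
  let lvl : ℕ → (ℕ →₀ ℕ) → V := fun k => Nat.rec (fun _ => sol f)
    (fun _ T s => sol (-∑ j ∈ s.support, B j (T (s - Finsupp.single j 1)))) k
  refine ⟨fun s => lvl s.degree s, ⟨fun w => ?_, fun s hs w => ?_⟩⟩
  · simp only [map_zero]
    exact hsol f w
  · obtain ⟨k, hk⟩ : ∃ k, s.degree = k + 1 :=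
      Nat.exists_eq_succ_of_ne_zero fun h => hs ((Finsupp.degree_eq_zero_iff s).1 h)
    have h1 : lvl s.degree s
        = sol (-∑ j ∈ s.support, B j (lvl k (s - Finsupp.single j 1))) := by
      rw [hk]
    simp only [h1, hsol, neg_apply, sum_apply]
    congr 1
    refine Finset.sum_congr rfl fun j hj => ?_
    have h2 : (s - Finsupp.single j 1).degree = k := by
      have := degree_sub_single_add_one hj
      omega
    rw [h2]

/-- The forms `B_j` are dominated by nonnegative quadratic functionals whose sum is at most
`θ a`. -/
structure IsDominated (a : V →L[ℝ] V →L[ℝ] ℝ) (B : ℕ → V →L[ℝ] V →L[ℝ] ℝ)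
    (p : ℕ → V → ℝ) (θ : ℝ) : Prop where
  nonneg : ∀ j v, 0 ≤ p j v
  bound : ∀ j v w, |B j v w| ≤ (p j v + p j w) / 2
  sum_le : ∀ (F : Finset ℕ) v, ∑ j ∈ F, p j v ≤ θ * a v v

section Energy

variable {a : V →L[ℝ] V →L[ℝ] ℝ} {B : ℕ → V →L[ℝ] V →L[ℝ] ℝ} {p : ℕ → V → ℝ} {θ : ℝ}
  {f : V →L[ℝ] ℝ} {τ : (ℕ →₀ ℕ) → V}

theorem sum_antidiag_energy_succ_le (hB : IsDominated a B p θ) (hτ : IsTaylorRecursion a B f τ)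
    (J k : ℕ) :
    (2 - θ) * ∑ s ∈ (Finset.range J).finsuppAntidiag (k + 1), a (τ s) (τ s)
      ≤ θ * ∑ s ∈ (Finset.range J).finsuppAntidiag k, a (τ s) (τ s) := by
  classical
  set A := (Finset.range J).finsuppAntidiag (k + 1) with hA
  set A' := (Finset.range J).finsuppAntidiag k with hA'
  have hdeg : ∀ {i : ℕ} {s : ℕ →₀ ℕ}, s ∈ (Finset.range J).finsuppAntidiag i ↔
      s.degree = i ∧ s.support ⊆ Finset.range J := by
    intro i s
    rw [Finset.mem_finsuppAntidiag', Finsupp.degree_apply]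
    rfl
  have hstep : ∀ s ∈ A, 2 * a (τ s) (τ s)
      ≤ ∑ j ∈ s.support, p j (τ (s - Finsupp.single j 1)) + θ * a (τ s) (τ s) := by
    intro s hs
    have hs0 : s ≠ 0 := by
      rintro rfl
      simpa using (hdeg.1 hs).1
    have h1 : a (τ s) (τ s)
        ≤ ∑ j ∈ s.support, (p j (τ (s - Finsupp.single j 1)) + p j (τ s)) / 2 := by
      rw [hτ.succ s hs0, ← Finset.sum_neg_distrib]
      exact Finset.sum_le_sum fun j _ => (neg_le_abs _).trans (hB.bound j _ _)
    rw [← Finset.sum_div, Finset.sum_add_distrib] at h1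
    have h2 := hB.sum_le s.support (τ s)
    linarith
  have hshift : ∑ s ∈ A, ∑ j ∈ s.support, p j (τ (s - Finsupp.single j 1))
      = ∑ s ∈ A', ∑ j ∈ Finset.range J, p j (τ s) := by
    rw [Finset.sum_sigma', Finset.sum_sigma']
    refine Finset.sum_bij' (fun x _ => ⟨x.1 - Finsupp.single x.2 1, x.2⟩)
      (fun x _ => ⟨x.1 + Finsupp.single x.2 1, x.2⟩) ?_ ?_ ?_ ?_ ?_
    · rintro ⟨s, j⟩ h
      obtain ⟨hs, hj⟩ := Finset.mem_sigma.1 h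
      have h1 := degree_sub_single_add_one hj
      have h2 := hdeg.1 hs
      refine Finset.mem_sigma.2 ⟨hdeg.2 ⟨?_, ?_⟩, h2.2 hj⟩
      · dsimp only at h1 h2 ⊢; omega
      · exact (Finsupp.support_mono tsub_le_self).trans h2.2
    · rintro ⟨s, j⟩ h
      obtain ⟨hs, hj⟩ := Finset.mem_sigma.1 h
      have h2 := hdeg.1 hs
      refine Finset.mem_sigma.2 ⟨hdeg.2 ⟨?_, ?_⟩, ?_⟩
      · simp [h2.1]
      · refine Finsupp.support_add.trans (Finset.union_subset h2.2 ?_)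
        exact Finsupp.support_single_subset.trans (Finset.singleton_subset_iff.2 hj)
      · simp
    · rintro ⟨s, j⟩ h
      obtain ⟨hs, hj⟩ := Finset.mem_sigma.1 h
      have : s - Finsupp.single j 1 + Finsupp.single j 1 = s :=
        tsub_add_cancel_of_le
          (Finsupp.single_le_iff.2 (Nat.one_le_iff_ne_zero.2 (Finsupp.mem_support_iff.1 hj)))
      simp [this]
    · rintro ⟨s, j⟩ h
      simp
    · rintro ⟨s, j⟩ h
      rfl
  have h1 := Finset.sum_le_sum hstep
  rw [Finset.sum_add_distrib, hshift, ← Finset.mul_sum, ← Finset.mul_sum] at h1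
  have h2 : ∑ s ∈ A', ∑ j ∈ Finset.range J, p j (τ s) ≤ ∑ s ∈ A', θ * a (τ s) (τ s) :=
    Finset.sum_le_sum fun s _ => hB.sum_le _ _
  rw [← Finset.mul_sum] at h2
  linarith

theorem sum_energy_le (ha : ∀ v, 0 ≤ a v v) (hθ0 : 0 ≤ θ) (hθ1 : θ < 1)
    (hB : IsDominated a B p θ) (hτ : IsTaylorRecursion a B f τ) (F : Finset (ℕ →₀ ℕ)) :
    ∑ s ∈ F, a (τ s) (τ s) ≤ (1 - θ)⁻¹ * a (τ 0) (τ 0) := by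
  classical
  have hdecay : ∀ J k, ∑ s ∈ (Finset.range J).finsuppAntidiag k, a (τ s) (τ s)
      ≤ θ ^ k * a (τ 0) (τ 0) := by
    intro J k
    induction k with
    | zero => simp
    | succ k ih =>
      have h1 := sum_antidiag_energy_succ_le hB hτ J k
      have h2 : 0 ≤ ∑ s ∈ (Finset.range J).finsuppAntidiag (k + 1), a (τ s) (τ s) :=
        Finset.sum_nonneg fun s _ => ha _
      have h3 : θ * ∑ s ∈ (Finset.range J).finsuppAntidiag k, a (τ s) (τ s)
          ≤ θ * (θ ^ k * a (τ 0) (τ 0)) := mul_le_mul_of_nonneg_left ih hθ0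
      have h4 : 0 ≤ (1 - θ) * ∑ s ∈ (Finset.range J).finsuppAntidiag (k + 1), a (τ s) (τ s) :=
        mul_nonneg (by linarith) h2
      calc _ ≤ θ * (θ ^ k * a (τ 0) (τ 0)) := by linarith
        _ = _ := by ring
  obtain ⟨J, hJ⟩ : ∃ J, ∀ s ∈ F, s.support ⊆ Finset.range J := by
    obtain ⟨J, hJ⟩ := (F.biUnion fun s => s.support).exists_nat_subset_range
    exact ⟨J, fun s hs => (Finset.subset_biUnion_of_mem (fun s : ℕ →₀ ℕ => s.support) hs).trans hJ⟩
  set N := (F.sup fun s => s.degree) + 1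
  have hsub : F ⊆ (Finset.range N).biUnion fun k => (Finset.range J).finsuppAntidiag k := by
    intro s hs
    refine Finset.mem_biUnion.2 ⟨s.degree, Finset.mem_range.2 (Nat.lt_succ_of_le
      (Finset.le_sup (f := fun s : ℕ →₀ ℕ => s.degree) hs)),
      Finset.mem_finsuppAntidiag'.2 ⟨?_, hJ s hs⟩⟩
    rw [Finsupp.degree_apply]
    rfl
  calc ∑ s ∈ F, a (τ s) (τ s)
      ≤ ∑ s ∈ (Finset.range N).biUnion fun k => (Finset.range J).finsuppAntidiag k,
          a (τ s) (τ s) := Finset.sum_le_sum_of_subset_of_nonneg hsub fun s _ _ => ha _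
    _ = ∑ k ∈ Finset.range N, ∑ s ∈ (Finset.range J).finsuppAntidiag k, a (τ s) (τ s) := by
        refine Finset.sum_biUnion fun k _ l _ hkl => Finset.disjoint_left.2 fun s hs hs' => hkl ?_
        exact (Finset.mem_finsuppAntidiag'.1 hs).1.symm.trans (Finset.mem_finsuppAntidiag'.1 hs').1
    _ ≤ ∑ k ∈ Finset.range N, θ ^ k * a (τ 0) (τ 0) :=
        Finset.sum_le_sum fun k _ => hdecay J k
    _ = (∑ k ∈ Finset.range N, θ ^ k) * a (τ 0) (τ 0) := by rw [Finset.sum_mul]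
    _ ≤ (1 - θ)⁻¹ * a (τ 0) (τ 0) := by
        refine mul_le_mul_of_nonneg_right ?_ (ha _)
        rw [← tsum_geometric_of_lt_one hθ0 hθ1]
        exact (summable_geometric_of_lt_one hθ0 hθ1).sum_le_tsum _ fun k _ => pow_nonneg hθ0 k

theorem sum_norm_sq_le {α : ℝ} (hα : 0 < α) (ha : ∀ v, α * ‖v‖ ^ 2 ≤ a v v) (hθ0 : 0 ≤ θ)
    (hθ1 : θ < 1) (hB : IsDominated a B p θ) (hτ : IsTaylorRecursion a B f τ)
    (F : Finset (ℕ →₀ ℕ)) :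
    ∑ s ∈ F, ‖τ s‖ ^ 2 ≤ (1 - θ)⁻¹ * (‖f‖ / α) ^ 2 := by
  have h0 : ∀ v, 0 ≤ a v v := fun v => le_trans (by positivity) (ha v)
  have h1 := sum_energy_le h0 hθ0 hθ1 hB hτ F
  have h2 : a (τ 0) (τ 0) ≤ ‖f‖ * ‖τ 0‖ := by
    rw [hτ.zero]
    exact (le_abs_self _).trans (f.le_opNorm _)
  have h3 : ‖τ 0‖ ≤ ‖f‖ / α := by
    rw [le_div_iff₀ hα]
    rcases (norm_nonneg (τ 0)).eq_or_lt with h | h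
    · rw [← h, zero_mul]; exact norm_nonneg f
    · have h4 := (ha (τ 0)).trans h2
      nlinarith
  have h4 : a (τ 0) (τ 0) ≤ α * (‖f‖ / α) ^ 2 := by
    refine h2.trans ((mul_le_mul_of_nonneg_left h3 (norm_nonneg f)).trans (le_of_eq ?_))
    field_simp
  have h5 : α * ∑ s ∈ F, ‖τ s‖ ^ 2 ≤ α * ((1 - θ)⁻¹ * (‖f‖ / α) ^ 2) := by
    rw [Finset.mul_sum]
    calc _ ≤ ∑ s ∈ F, a (τ s) (τ s) := Finset.sum_le_sum fun s _ => ha _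
      _ ≤ (1 - θ)⁻¹ * a (τ 0) (τ 0) := h1
      _ ≤ (1 - θ)⁻¹ * (α * (‖f‖ / α) ^ 2) :=
        mul_le_mul_of_nonneg_left h4 (inv_nonneg.2 (by linarith))
      _ = _ := by ring
  exact le_of_mul_le_mul_left h5 hα

end Energy

end Recursion

section Solve

variable {V : Type*} [NormedAddCommGroup V] [InnerProductSpace ℝ V]
variable {a : V →L[ℝ] V →L[ℝ] ℝ} {B : ℕ → V →L[ℝ] V →L[ℝ] ℝ} {p : ℕ → V → ℝ} {θ : ℝ}
  {f : V →L[ℝ] ℝ} {τ : (ℕ →₀ ℕ) → V}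

theorem IsDominated.sum_abs_le (hB : IsDominated a B p θ) (hθ0 : 0 ≤ θ) (F : Finset ℕ) (v w : V) :
    ∑ j ∈ F, |B j v w| ≤ θ * ‖a‖ * ‖v‖ * ‖w‖ := by
  rcases eq_or_ne v 0 with rfl | hv
  · simp
  rcases eq_or_ne w 0 with rfl | hw
  · simp
  have hunit : ∀ v w : V, ‖v‖ = 1 → ‖w‖ = 1 → ∑ j ∈ F, |B j v w| ≤ θ * ‖a‖ := by
    intro v w hv hw
    have h1 : ∑ j ∈ F, |B j v w| ≤ ∑ j ∈ F, (p j v + p j w) / 2 :=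
      Finset.sum_le_sum fun j _ => hB.bound j v w
    rw [← Finset.sum_div, Finset.sum_add_distrib] at h1
    have h2 : ∀ v : V, ‖v‖ = 1 → a v v ≤ ‖a‖ := by
      intro v hv
      have := (le_abs_self _).trans (a.le_opNorm₂ v v)
      simpa [hv] using this
    have h3 := (hB.sum_le F v).trans (mul_le_mul_of_nonneg_left (h2 v hv) hθ0)
    have h4 := (hB.sum_le F w).trans (mul_le_mul_of_nonneg_left (h2 w hw) hθ0)
    linarith
  have hv' : ‖v‖ ≠ 0 := norm_ne_zero_iff.2 hv
  have hw' : ‖w‖ ≠ 0 := norm_ne_zero_iff.2 hw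
  have h := hunit (‖v‖⁻¹ • v) (‖w‖⁻¹ • w) (by simp [norm_smul, hv']) (by simp [norm_smul, hw'])
  have h1 : ∀ j, |B j v w| = ‖v‖ * ‖w‖ * |B j (‖v‖⁻¹ • v) (‖w‖⁻¹ • w)| := by
    intro j
    simp only [map_smul, smul_apply, smul_eq_mul, abs_mul, abs_inv, abs_norm]
    field_simp
  simp_rw [h1, ← Finset.mul_sum]
  calc _ ≤ ‖v‖ * ‖w‖ * (θ * ‖a‖) := mul_le_mul_of_nonneg_left h (by positivity)
    _ = _ := by ring

theorem IsDominated.eq_of_hasSum (hB : IsDominated a B p θ) {α : ℝ} (hα : 0 < α)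
    (ha : ∀ v, α * ‖v‖ ^ 2 ≤ a v v) (hθ1 : θ < 1) {z : ℕ → ℝ} (hz : ∀ j, |z j| ≤ 1) {u v : V}
    (hu : ∀ w, HasSum (fun j => z j * B j u w) (f w - a u w))
    (hv : ∀ w, HasSum (fun j => z j * B j v w) (f w - a v w)) : u = v := by
  set e := u - v
  have h1 : HasSum (fun j => z j * B j e e) (-a e e) := by
    have h := (hu e).sub (hv e)
    simp only [← mul_sub, ← sub_apply, ← map_sub, sub_sub_sub_cancel_left] at h
    have h' : a (v - u) e = -a e e := by
      rw [← neg_sub u v, map_neg, neg_apply]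
    rwa [h'] at h
  have h2 : -(θ * a e e) ≤ -a e e := by
    refine ge_of_tendsto' h1 fun F => ?_
    have h3 : ∑ j ∈ F, -(z j * B j e e) ≤ θ * a e e := by
      refine (Finset.sum_le_sum fun j _ => ?_).trans (hB.sum_le F e)
      calc -(z j * B j e e) ≤ |z j| * |B j e e| := by rw [← abs_mul]; exact neg_le_abs _
        _ ≤ 1 * |B j e e| := mul_le_mul_of_nonneg_right (hz j) (abs_nonneg _)
        _ ≤ p j e := by have := hB.bound j e e; linarith
    rw [Finset.sum_neg_distrib] at h3
    linarith
  have h3 := ha e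
  have h4 : a e e ≤ 0 := by
    by_contra hc
    nlinarith
  have h5 : ‖e‖ = 0 := by
    by_contra hc
    have := mul_pos hα (pow_pos ((norm_nonneg e).lt_of_ne' hc) 2)
    linarith
  exact sub_eq_zero.1 (norm_eq_zero.1 h5)

/-- Pairs `(s, j)` correspond to pairs of a multi-index `s' = s + e_j` and an element `j` of its
support. -/
noncomputable def supportSigmaEquiv : (Σ s : ℕ →₀ ℕ, {j // j ∈ s.support}) ≃ (ℕ →₀ ℕ) × ℕ where
  toFun x := (x.1 - Finsupp.single x.2.1 1, x.2.1)
  invFun x := ⟨x.1 + Finsupp.single x.2 1, ⟨x.2, by simp⟩⟩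
  left_inv := by
    rintro ⟨s, j, hj⟩
    have h : s - Finsupp.single j 1 + Finsupp.single j 1 = s :=
      tsub_add_cancel_of_le
        (Finsupp.single_le_iff.2 (Nat.one_le_iff_ne_zero.2 (Finsupp.mem_support_iff.1 hj)))
    refine Sigma.ext h ?_
    refine (Subtype.heq_iff_coe_eq ?_).2 rfl
    simp [h]
  right_inv := by
    rintro ⟨s, j⟩
    simp

theorem hasSum_powerSeries_apply [CompleteSpace V] (hB : IsDominated a B p θ) (hθ0 : 0 ≤ θ)
    (hτ : IsTaylorRecursion a B f τ) {z : ℕ → ℝ} (hz : ∀ j, |z j| ≤ 1)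
    (hs : Summable fun s => ‖sigmaWeight z s • τ s‖) (w : V) :
    HasSum (fun j => z j * B j (∑' s, sigmaWeight z s • τ s) w)
      (f w - a (∑' s, sigmaWeight z s • τ s) w) := by
  set U := ∑' s, sigmaWeight z s • τ s with hU
  have hUs : HasSum (fun s => sigmaWeight z s • τ s) U := hs.of_norm.hasSum
  have happ : ∀ c : V →L[ℝ] V →L[ℝ] ℝ, HasSum (fun s => sigmaWeight z s * c (τ s) w) (c U w) := by
    intro c
    have := hUs.mapL (c.flip w)
    simpa using this
  set g : (ℕ →₀ ℕ) × ℕ → ℝ := fun x => sigmaWeight z x.1 * (z x.2 * B x.2 (τ x.1) w) with hg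
  have hgs : Summable g := by
    refine Summable.of_norm ?_
    have hbd : ∀ s (F : Finset ℕ), ∑ j ∈ F, ‖g (s, j)‖
        ≤ θ * ‖a‖ * ‖w‖ * ‖sigmaWeight z s • τ s‖ := by
      intro s F
      have h1 := hB.sum_abs_le hθ0 F (sigmaWeight z s • τ s) w
      refine (Finset.sum_le_sum fun j _ => ?_).trans (h1.trans (le_of_eq (by ring)))
      simp only [hg, map_smul, smul_apply, smul_eq_mul, Real.norm_eq_abs, abs_mul]
      refine mul_le_mul_of_nonneg_left ?_ (abs_nonneg _)
      exact mul_le_of_le_one_left (abs_nonneg _) (hz j)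
    refine (summable_prod_of_nonneg fun x => norm_nonneg _).2 ⟨fun s => ?_, ?_⟩
    · exact summable_of_sum_le (fun j => norm_nonneg _) (hbd s)
    · refine Summable.of_nonneg_of_le (fun s => tsum_nonneg fun j => norm_nonneg _) (fun s => ?_)
        (hs.mul_left (θ * ‖a‖ * ‖w‖))
      exact Real.tsum_le_of_sum_le (fun j => norm_nonneg _) (hbd s)
  have hrows : HasSum (fun j => z j * B j U w) (∑' x, g x) := by
    have h1 : HasSum (fun x : ℕ × (ℕ →₀ ℕ) => g x.swap) (∑' x, g x) :=
      (Equiv.prodComm ℕ (ℕ →₀ ℕ)).hasSum_iff.2 hgs.hasSum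
    refine h1.prod_fiberwise fun j => ?_
    have h2 := (happ (B j)).mul_left (z j)
    simp only [mul_left_comm (z j)] at h2
    exact h2
  have hcols : HasSum (fun s : ℕ →₀ ℕ => ∑ j : {j // j ∈ s.support}, g (supportSigmaEquiv ⟨s, j⟩))
      (∑' x, g x) := by
    have h1 : HasSum (g ∘ supportSigmaEquiv) (∑' x, g x) :=
      supportSigmaEquiv.hasSum_iff.2 hgs.hasSum
    exact h1.sigma fun s => hasSum_fintype _
  have hfib : ∀ s : ℕ →₀ ℕ, ∑ j : {j // j ∈ s.support}, g (supportSigmaEquiv ⟨s, j⟩)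
      = (if s = 0 then f w else 0) - sigmaWeight z s * a (τ s) w := by
    intro s
    have h1 : ∑ j : {j // j ∈ s.support}, g (supportSigmaEquiv ⟨s, j⟩)
        = sigmaWeight z s * ∑ j ∈ s.support, B j (τ (s - Finsupp.single j 1)) w := by
      rw [Finset.mul_sum, ← Finset.sum_coe_sort s.support]
      refine Finset.sum_congr rfl fun j _ => ?_
      have h2 : s - Finsupp.single j.1 1 + Finsupp.single j.1 1 = s :=
        tsub_add_cancel_of_le (Finsupp.single_le_iff.2
          (Nat.one_le_iff_ne_zero.2 (Finsupp.mem_support_iff.1 j.2)))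
      have h3 : sigmaWeight z s = sigmaWeight z (s - Finsupp.single j.1 1) * z j.1 := by
        conv_lhs => rw [← h2, sigmaWeight_add, sigmaWeight_single, pow_one]
      rw [h3]
      exact (mul_assoc _ _ _).symm
    rw [h1]
    split_ifs with h0
    · subst h0
      simp [sigmaWeight_zero, hτ.zero]
    · rw [hτ.succ s h0]
      ring
  simp only [hfib] at hcols
  have h1 : HasSum (fun s : ℕ →₀ ℕ => (if s = 0 then f w else 0) - sigmaWeight z s * a (τ s) w)
      (f w - a U w) := (hasSum_ite_eq 0 (f w)).sub (happ a)
  rwa [hcols.unique h1] at hrows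

end Solve

section PowerSeries

variable {X : Type*} [NormedAddCommGroup X] [NormedSpace ℝ X]

/-- The absolutely convergent expansion `g(y) = ∑_s y^s c_s` on the open cube `|y_j| < 1`. -/
def HasExpansion (c : (ℕ →₀ ℕ) → X) (g : (ℕ → ℝ) → X) : Prop :=
  ∀ y : ℕ → ℝ, (∀ j, |y j| < 1) →
    (Summable fun s => ‖sigmaWeight y s • c s‖) ∧ HasSum (fun s => sigmaWeight y s • c s) (g y)

theorem sigmaWeight_update (y : ℕ → ℝ) (j : ℕ) (t : ℝ) (s : ℕ →₀ ℕ) :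
    sigmaWeight (Function.update y j t) s
      = t ^ s j * sigmaWeight (Function.update y j 1) s := by
  classical
  have h : ∀ r : ℝ, sigmaWeight (Function.update y j r) s
      = r ^ s j * ∏ i ∈ s.support.erase j, y i ^ s i := by
    intro r
    rw [sigmaWeight_eq_prod_of_support_subset _ s (Finset.subset_insert j s.support),
      ← Finset.insert_erase (Finset.mem_insert_self j s.support),
      Finset.prod_insert (Finset.notMem_erase j _), Function.update_self]
    congr 1
    rw [Finset.erase_insert_eq_erase]
    refine Finset.prod_congr rfl fun i hi => ?_
    rw [Function.update_of_ne (Finset.ne_of_mem_erase hi)]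
  rw [h, h, one_pow, one_mul]

/-- The coefficients of the derivative of a power series in the `j`-th variable. -/
noncomputable def derivCoeff (j : ℕ) (c : (ℕ →₀ ℕ) → X) : (ℕ →₀ ℕ) → X :=
  fun s => ((s j : ℝ) + 1) • c (s + Finsupp.single j 1)

theorem exists_natCast_mul_pow_le {r r' : ℝ} (hr : 0 ≤ r) (hrr' : r < r') :
    ∃ M, ∀ k : ℕ, (k : ℝ) * r ^ (k - 1) ≤ M * r' ^ k := by
  have hd : 0 < r' - r := sub_pos.2 hrr'
  have key : ∀ k : ℕ, ((k : ℝ) + 1) * r ^ k * (r' - r) + r ^ (k + 1) ≤ r' ^ (k + 1) := by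
    intro k
    induction k with
    | zero => simp
    | succ k ih =>
      have h1 := mul_le_mul_of_nonneg_left ih (hr.trans hrr'.le)
      have h2 : 0 ≤ ((k : ℝ) + 1) * r ^ k * (r' - r) := by positivity
      have h3 := mul_le_mul_of_nonneg_right hrr'.le h2
      push_cast
      calc _ = r * (((k : ℝ) + 1) * r ^ k * (r' - r)) + r' * r ^ (k + 1) := by ring
        _ ≤ r' * (((k : ℝ) + 1) * r ^ k * (r' - r) + r ^ (k + 1)) := by linarith
        _ ≤ r' * r' ^ (k + 1) := h1
        _ = _ := by ring
  refine ⟨(r' - r)⁻¹, fun k => ?_⟩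
  rw [inv_mul_eq_div, le_div_iff₀ hd]
  cases k with
  | zero => simp
  | succ k =>
    have h1 := key k
    have h2 : 0 ≤ r ^ (k + 1) := pow_nonneg hr _
    push_cast
    linarith

theorem hasExpansion_partialDeriv [CompleteSpace X] {c : (ℕ →₀ ℕ) → X} {g : (ℕ → ℝ) → X}
    (h : HasExpansion c g) (j : ℕ) : HasExpansion (derivCoeff j c) (partialDeriv j g) := by
  intro y hy
  obtain ⟨r, hyr, hr1⟩ := exists_between (hy j)
  obtain ⟨r', hrr', hr'1⟩ := exists_between hr1
  have hr0 : 0 ≤ r := (abs_nonneg _).trans hyr.le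
  obtain ⟨M, hM⟩ := exists_natCast_mul_pow_le hr0 hrr'
  set d : (ℕ →₀ ℕ) → X := fun s => sigmaWeight (Function.update y j 1) s • c s with hd
  have hupd : ∀ t s, sigmaWeight (Function.update y j t) s • c s = t ^ s j • d s := by
    intro t s
    rw [sigmaWeight_update, mul_smul]
  have hcube : ∀ t : ℝ, |t| < 1 → ∀ i, |Function.update y j t i| < 1 := by
    intro t ht i
    rcases eq_or_ne i j with rfl | hi
    · simpa using ht
    · simpa [hi] using hy i
  have habs : ∀ t : ℝ, |t| < 1 → (Summable fun s => ‖t ^ s j • d s‖) ∧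
      HasSum (fun s => t ^ s j • d s) (g (Function.update y j t)) := by
    intro t ht
    simpa only [hupd] using h _ (hcube t ht)
  have hbound : Summable fun s => M * ‖r' ^ s j • d s‖ :=
    (habs r' (by rwa [abs_of_nonneg (hr0.trans hrr'.le)])).1.mul_left M
  have hle : ∀ (s : ℕ →₀ ℕ) (t : ℝ), t ∈ Metric.ball (0 : ℝ) r →
      ‖((s j : ℝ) * t ^ (s j - 1)) • d s‖ ≤ M * ‖r' ^ s j • d s‖ := by
    intro s t ht
    have ht' : |t| ≤ r := by
      rw [mem_ball_zero_iff, Real.norm_eq_abs] at ht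
      exact ht.le
    rw [norm_smul _ (d s), norm_smul _ (d s), ← mul_assoc]
    refine mul_le_mul_of_nonneg_right ?_ (norm_nonneg (d s))
    rw [norm_mul, norm_pow, norm_pow, Real.norm_natCast, Real.norm_eq_abs,
      Real.norm_of_nonneg (hr0.trans hrr'.le)]
    exact (mul_le_mul_of_nonneg_left (pow_le_pow_left₀ (abs_nonneg t) ht' _)
      (Nat.cast_nonneg _)).trans (hM _)
  have hmem : y j ∈ Metric.ball (0 : ℝ) r := by
    rw [mem_ball_zero_iff, Real.norm_eq_abs]; exact hyr
  have hder : HasDerivAt (fun t : ℝ => ∑' s, t ^ s j • d s)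
      (∑' s : ℕ →₀ ℕ, ((s j : ℝ) * y j ^ (s j - 1)) • d s) (y j) :=
    hasDerivAt_tsum_of_isPreconnected hbound Metric.isOpen_ball
      (convex_ball (0 : ℝ) r).isPreconnected
      (fun s t _ => (hasDerivAt_pow (s j) t).smul_const (d s)) hle hmem
      (Summable.of_norm (habs (y j) (hy j)).1) hmem
  have hderiv : partialDeriv j g y = ∑' s : ℕ →₀ ℕ, ((s j : ℝ) * y j ^ (s j - 1)) • d s := by
    refine (hder.congr_of_eventuallyEq ?_).deriv
    filter_upwards [Metric.isOpen_ball.mem_nhds hmem] with t ht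
    rw [mem_ball_zero_iff, Real.norm_eq_abs] at ht
    exact (habs t (ht.trans hr1)).2.tsum_eq.symm
  have hterm : ∀ s : ℕ →₀ ℕ, sigmaWeight y s • derivCoeff j c s
      = (((s + Finsupp.single j 1 : ℕ →₀ ℕ) j : ℝ) *
          y j ^ ((s + Finsupp.single j 1 : ℕ →₀ ℕ) j - 1)) •
        d (s + Finsupp.single j 1) := by
    intro s
    have h1 : sigmaWeight y s = y j ^ s j * sigmaWeight (Function.update y j 1) s := by
      rw [← sigmaWeight_update, Function.update_eq_self]
    simp only [derivCoeff, hd, h1, sigmaWeight_add, sigmaWeight_single, Finsupp.add_apply,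
      Finsupp.single_eq_same, Function.update_self, smul_smul]
    congr 1
    push_cast
    ring
  have hinj : Function.Injective fun s : ℕ →₀ ℕ => s + Finsupp.single j 1 :=
    add_left_injective _
  have hsupp : ∀ s : ℕ →₀ ℕ, s ∉ Set.range (fun s : ℕ →₀ ℕ => s + Finsupp.single j 1) →
      ((s j : ℝ) * y j ^ (s j - 1)) • d s = 0 := by
    intro s hs
    have h0 : s j = 0 := by
      by_contra hc
      exact hs ⟨s - Finsupp.single j 1, tsub_add_cancel_of_le
        (Finsupp.single_le_iff.2 (Nat.one_le_iff_ne_zero.2 hc))⟩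
    simp [h0]
  have hsumm : Summable fun s : ℕ →₀ ℕ => ‖((s j : ℝ) * y j ^ (s j - 1)) • d s‖ :=
    Summable.of_nonneg_of_le (fun s => norm_nonneg _) (fun s => hle s (y j) hmem) hbound
  refine ⟨?_, ?_⟩
  · simp only [hterm]
    exact hsumm.comp_injective hinj
  · simp only [hterm, hderiv]
    exact (hinj.hasSum_iff hsupp).2 (Summable.of_norm hsumm).hasSum

theorem HasExpansion.iterate_partialDeriv [CompleteSpace X] {c : (ℕ →₀ ℕ) → X} {g : (ℕ → ℝ) → X}
    (h : HasExpansion c g) (j k : ℕ) :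
    HasExpansion ((derivCoeff j)^[k] c) ((partialDeriv j)^[k] g) := by
  induction k with
  | zero => exact h
  | succ k ih =>
    rw [Function.iterate_succ_apply', Function.iterate_succ_apply']
    exact hasExpansion_partialDeriv ih j

theorem iterate_derivCoeff_apply (j k : ℕ) (c : (ℕ →₀ ℕ) → X) (s : ℕ →₀ ℕ) (hs : s j = 0) :
    (derivCoeff j)^[k] c s = (k.factorial : ℝ) • c (s + Finsupp.single j k) := by
  induction k generalizing c with
  | zero => simp
  | succ k ih =>
    rw [Function.iterate_succ_apply, ih, derivCoeff, smul_smul, add_assoc, ← Finsupp.single_add]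
    congr 1
    simp [hs, Nat.factorial_succ, mul_comm]

theorem HasExpansion.foldr_partialDeriv [CompleteSpace X] {c : (ℕ →₀ ℕ) → X} {g : (ℕ → ℝ) → X}
    (h : HasExpansion c g) (s : ℕ →₀ ℕ) (l : List ℕ) :
    HasExpansion (l.foldr (fun j h => (derivCoeff j)^[s j] h) c)
      (l.foldr (fun j h => (partialDeriv j)^[s j] h) g) := by
  induction l with
  | nil => exact h
  | cons j l ih => exact ih.iterate_partialDeriv j (s j)

theorem foldr_derivCoeff_apply (c : (ℕ →₀ ℕ) → X) (s : ℕ →₀ ℕ) (l : List ℕ) (hl : l.Nodup)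
    (r : ℕ →₀ ℕ) (hr : ∀ j ∈ l, r j = 0) :
    l.foldr (fun j h => (derivCoeff j)^[s j] h) c r
      = ((l.map fun j => ((s j).factorial : ℝ)).prod) •
        c (r + (l.map fun j => Finsupp.single j (s j)).sum) := by
  induction l generalizing r with
  | nil => simp
  | cons j l ih =>
    obtain ⟨hj, hl'⟩ := List.nodup_cons.1 hl
    rw [List.foldr_cons, iterate_derivCoeff_apply _ _ _ _ (hr j (by simp)), ih hl', smul_smul,
      List.map_cons, List.prod_cons, List.map_cons, List.sum_cons, add_assoc]
    intro i hi
    have hij : i ≠ j := fun h => hj (h ▸ hi)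
    simp [hr i (by simp [hi]), hij]

theorem HasExpansion.taylorCoeff_eq [CompleteSpace X] {c : (ℕ →₀ ℕ) → X} {g : (ℕ → ℝ) → X}
    (h : HasExpansion c g) (s : ℕ →₀ ℕ) : taylorCoeff g s = c s := by
  have h1 := h.foldr_partialDeriv s (s.support.sort (· ≤ ·))
  set c' := (s.support.sort (· ≤ ·)).foldr (fun j h => (derivCoeff j)^[s j] h) c with hc'
  have h2 : mixedPartial s g 0 = c' 0 := by
    have h3 := (h1 0 (by simp)).2
    have h4 : HasSum (fun s => sigmaWeight 0 s • c' s) (c' 0) := by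
      have h5 := hasSum_single (f := fun s => sigmaWeight 0 s • c' s) 0 (fun s hs => by
        obtain ⟨j, hj⟩ := Finsupp.support_nonempty_iff.2 hs
        have : sigmaWeight 0 s = 0 :=
          Finset.prod_eq_zero hj (zero_pow (Finsupp.mem_support_iff.1 hj))
        simp [this])
      simpa [sigmaWeight_zero] using h5
    exact h3.unique h4
  have h3 : c' 0 = (s.prod fun _ k => (Nat.factorial k : ℝ)) • c s := by
    rw [hc', foldr_derivCoeff_apply c s _ (Finset.sort_nodup _ _) 0 (by simp), zero_add]
    congr 1
    · rw [Finsupp.prod, ← Finset.prod_map_toList]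
      exact ((Finset.sort_perm_toList _ _).map _).prod_eq
    · congr 1
      conv_rhs => rw [← Finsupp.sum_single s, Finsupp.sum, ← Finset.sum_map_toList]
      exact ((Finset.sort_perm_toList _ _).map _).sum_eq
  rw [taylorCoeff, h2, h3, smul_smul, inv_mul_cancel₀, one_smul]
  exact Finset.prod_ne_zero_iff.2 fun j _ => Nat.cast_ne_zero.2 (Nat.factorial_ne_zero _)

theorem hasExpansion_of_summable [CompleteSpace X] {c : (ℕ →₀ ℕ) → X} {g : (ℕ → ℝ) → X}
    (hc : Summable fun s => ‖c s‖)
    (hg : ∀ y : ℕ → ℝ, (∀ j, |y j| < 1) → g y = ∑' s, sigmaWeight y s • c s) :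
    HasExpansion c g := by
  intro y hy
  have h1 : Summable fun s => ‖sigmaWeight y s • c s‖ := by
    refine Summable.of_nonneg_of_le (fun s => norm_nonneg _) (fun s => ?_) hc
    rw [norm_smul]
    exact mul_le_of_le_one_left (norm_nonneg _) (abs_sigmaWeight_le_one (fun j => (hy j).le) s)
  exact ⟨h1, hg y hy ▸ (Summable.of_norm h1).hasSum⟩

end PowerSeries

section Approximation

variable {V : Type*} [NormedAddCommGroup V] [NormedSpace ℝ V] {q : ℝ} {ρ : ℕ → ℝ}

theorem sum_norm_le_of_sum_sq_le (hρ_one : ∀ j, 1 < ρ j) {t : (ℕ →₀ ℕ) → V} {E : ℝ} (hE : 0 ≤ E)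
    (ht : ∀ F : Finset (ℕ →₀ ℕ), ∑ s ∈ F, ‖sigmaWeight ρ s • t s‖ ^ 2 ≤ E ^ 2)
    (F : Finset (ℕ →₀ ℕ)) {A : ℝ} (hA : ∑ s ∈ F, (sigmaWeight ρ s ^ 2)⁻¹ ≤ A) :
    ∑ s ∈ F, ‖t s‖ ≤ E * √A := by
  have hpos : ∀ s, 0 < sigmaWeight ρ s := sigmaWeight_pos fun j => zero_lt_one.trans (hρ_one j)
  have h1 : ∀ s, ‖t s‖ = ‖sigmaWeight ρ s • t s‖ * (sigmaWeight ρ s)⁻¹ := fun s => by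
    rw [norm_smul, Real.norm_of_nonneg (hpos s).le]
    field_simp [(hpos s).ne']
  have hA0 : 0 ≤ A := le_trans (Finset.sum_nonneg fun s _ => by positivity) hA
  refine le_of_sq_le_sq ?_ (by positivity)
  calc (∑ s ∈ F, ‖t s‖) ^ 2
      = (∑ s ∈ F, ‖sigmaWeight ρ s • t s‖ * (sigmaWeight ρ s)⁻¹) ^ 2 := by simp_rw [← h1]
    _ ≤ (∑ s ∈ F, ‖sigmaWeight ρ s • t s‖ ^ 2) * ∑ s ∈ F, ((sigmaWeight ρ s)⁻¹) ^ 2 :=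
        Finset.sum_mul_sq_le_sq_mul_sq _ _ _
    _ ≤ E ^ 2 * A := by
        refine mul_le_mul (ht F) ?_ (Finset.sum_nonneg fun s _ => by positivity) (sq_nonneg E)
        simpa only [inv_pow] using hA
    _ = (E * √A) ^ 2 := by rw [mul_pow, Real.sq_sqrt hA0]

theorem summable_norm_of_sum_sq_le (hq2 : q < 2) (hρ_one : ∀ j, 1 < ρ j)
    (hs : Summable fun s => (sigmaWeight ρ s ^ q)⁻¹) {t : (ℕ →₀ ℕ) → V} {E : ℝ} (hE : 0 ≤ E)
    (ht : ∀ F : Finset (ℕ →₀ ℕ), ∑ s ∈ F, ‖sigmaWeight ρ s • t s‖ ^ 2 ≤ E ^ 2) :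
    Summable fun s => ‖t s‖ := by
  have hpos : ∀ s, 0 < sigmaWeight ρ s := sigmaWeight_pos fun j => zero_lt_one.trans (hρ_one j)
  refine summable_of_sum_le (fun s => norm_nonneg _) fun F =>
    sum_norm_le_of_sum_sq_le hρ_one hE ht F (A := ∑' s, (sigmaWeight ρ s ^ q)⁻¹) ?_
  exact (Finset.sum_le_sum fun s _ => sigmaWeight_sq_inv_le hq2 hρ_one s).trans
    (hs.sum_le_tsum F fun s _ => (inv_pos.2 (Real.rpow_pos_of_pos (hpos s) q)).le)

theorem norm_sub_sum_le [CompleteSpace V] (hq0 : 0 < q) (hq2 : q < 2) (hρ_one : ∀ j, 1 < ρ j)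
    (hs : Summable fun s => (sigmaWeight ρ s ^ q)⁻¹) {t : (ℕ →₀ ℕ) → V} {E : ℝ} (hE : 0 ≤ E)
    (ht : ∀ F : Finset (ℕ →₀ ℕ), ∑ s ∈ F, ‖sigmaWeight ρ s • t s‖ ^ 2 ≤ E ^ 2)
    {y : ℕ → ℝ} (hy : ∀ j, |y j| ≤ 1) {ξ : ℝ} (hξ : 0 < ξ) {F : Finset (ℕ →₀ ℕ)}
    (hF : ∀ s, s ∈ F ↔ s ∈ LambdaSet q ρ ξ) {φ : (ℕ →₀ ℕ) → ℝ} {δ : ℝ} (hδ : 0 ≤ δ)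
    (hφ : ∀ s ∈ F, |φ s - sigmaWeight y s| ≤ δ) :
    ‖(∑' s, sigmaWeight y s • t s) - ∑ s ∈ F, φ s • t s‖
      ≤ E * √(∑' s, (sigmaWeight ρ s ^ q)⁻¹) * (ξ ^ (-(1 / q - 1 / 2)) + δ) := by
  classical
  have hpos : ∀ s, 0 < sigmaWeight ρ s := sigmaWeight_pos fun j => zero_lt_one.trans (hρ_one j)
  set S := ∑' s, (sigmaWeight ρ s ^ q)⁻¹ with hS
  have hS0 : 0 ≤ S := tsum_nonneg fun s => (inv_pos.2 (Real.rpow_pos_of_pos (hpos s) q)).le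
  have hSle : ∀ G : Finset (ℕ →₀ ℕ), ∑ s ∈ G, (sigmaWeight ρ s ^ q)⁻¹ ≤ S := fun G =>
    hs.sum_le_tsum G fun s _ => (inv_pos.2 (Real.rpow_pos_of_pos (hpos s) q)).le
  have hall : ∀ G : Finset (ℕ →₀ ℕ), ∑ s ∈ G, ‖t s‖ ≤ E * √S := fun G =>
    sum_norm_le_of_sum_sq_le hρ_one hE ht G
      ((Finset.sum_le_sum fun s _ => sigmaWeight_sq_inv_le hq2 hρ_one s).trans (hSle G))
  have htail : ∀ G : Finset (ℕ →₀ ℕ), (∀ s ∈ G, s ∉ F) →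
      ∑ s ∈ G, ‖t s‖ ≤ E * √S * ξ ^ (-(1 / q - 1 / 2)) := by
    intro G hG
    have h1 : ∑ s ∈ G, (sigmaWeight ρ s ^ 2)⁻¹ ≤ S * ξ ^ (-(2 / q - 1)) := by
      refine (Finset.sum_le_sum fun s hsG => sigmaWeight_sq_inv_le_of_notMem hq0 hq2 hρ_one hξ
        fun h => hG s hsG ((hF s).2 h)).trans ?_
      rw [← Finset.sum_mul]
      exact mul_le_mul_of_nonneg_right (hSle G) (Real.rpow_nonneg hξ.le _)
    refine (sum_norm_le_of_sum_sq_le hρ_one hE ht G h1).trans (le_of_eq ?_)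
    rw [Real.sqrt_mul hS0, mul_assoc]
    congr 2
    rw [Real.sqrt_eq_rpow, ← Real.rpow_mul hξ.le]
    congr 1
    ring
  have hsum : HasSum (fun s => sigmaWeight y s • t s - if s ∈ F then φ s • t s else 0)
      ((∑' s, sigmaWeight y s • t s) - ∑ s ∈ F, φ s • t s) := by
    refine HasSum.sub ?_ ?_
    · refine (Summable.of_norm_bounded (summable_norm_of_sum_sq_le hq2 hρ_one hs hE ht)
        fun s => ?_).hasSum
      rw [norm_smul]
      exact mul_le_of_le_one_left (norm_nonneg _) (abs_sigmaWeight_le_one hy s)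
    · have h2 : HasSum (fun s => if s ∈ F then φ s • t s else 0)
          (∑ s ∈ F, if s ∈ F then φ s • t s else 0) :=
        hasSum_sum_of_ne_finset_zero fun s hsF => if_neg hsF
      rwa [Finset.sum_congr rfl fun s hsF => if_pos hsF] at h2
  refine le_of_tendsto' hsum.norm fun G => (norm_sum_le _ _).trans ?_
  rw [← Finset.sum_filter_add_sum_filter_not G (· ∈ F)]
  have h1 : ∑ s ∈ G with s ∈ F, ‖sigmaWeight y s • t s - if s ∈ F then φ s • t s else 0‖
      ≤ δ * (E * √S) := by
    refine le_trans (Finset.sum_le_sum (g := fun s => δ * ‖t s‖) fun s hsG => ?_) ?_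
    · have hsF := (Finset.mem_filter.1 hsG).2
      rw [if_pos hsF, ← sub_smul, norm_smul, Real.norm_eq_abs, abs_sub_comm]
      exact mul_le_mul_of_nonneg_right (hφ s hsF) (norm_nonneg _)
    · rw [← Finset.mul_sum]
      exact mul_le_mul_of_nonneg_left (hall _) hδ
  have h2 : ∑ s ∈ G with s ∉ F, ‖sigmaWeight y s • t s - if s ∈ F then φ s • t s else 0‖
      ≤ E * √S * ξ ^ (-(1 / q - 1 / 2)) := by
    refine le_trans (Finset.sum_le_sum (g := fun s => ‖t s‖) fun s hsG => ?_)
      (htail _ fun s hsG => (Finset.mem_filter.1 hsG).2)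
    rw [if_neg (Finset.mem_filter.1 hsG).2, sub_zero, norm_smul]
    exact mul_le_of_le_one_left (norm_nonneg _) (abs_sigmaWeight_le_one hy s)
  calc _ ≤ δ * (E * √S) + E * √S * ξ ^ (-(1 / q - 1 / 2)) := add_le_add h1 h2
    _ = _ := by ring

end Approximation

section Parametric

variable {V : Type*} [NormedAddCommGroup V] [InnerProductSpace ℝ V] [CompleteSpace V]
  {q : ℝ} {ρ : ℕ → ℝ}

/-- Weighted `ℓ_2`-summability of the Taylor coefficients of a parametric solution, and its
consequence for the approximation of the solution by perturbed monomials. -/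
theorem norm_solution_sub_sum_le (hq0 : 0 < q) (hq2 : q < 2) (hρ_one : ∀ j, 1 < ρ j)
    (hs : Summable fun s => (sigmaWeight ρ s ^ q)⁻¹)
    {a : V →L[ℝ] V →L[ℝ] ℝ} {b : ℕ → V →L[ℝ] V →L[ℝ] ℝ} {p : ℕ → V → ℝ} {θ α : ℝ}
    (hα : 0 < α) (ha : ∀ v, α * ‖v‖ ^ 2 ≤ a v v) (hθ0 : 0 ≤ θ) (hθ1 : θ < 1)
    (hb : IsDominated a (fun j => ρ j • b j) p θ) (f : V →L[ℝ] ℝ) {u : (ℕ → ℝ) → V}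
    (hu : ∀ y : ℕ → ℝ, (∀ j, |y j| ≤ 1) → ∀ w,
      HasSum (fun j => y j * b j (u y) w) (f w - a (u y) w))
    {y : ℕ → ℝ} (hy : ∀ j, |y j| ≤ 1) {ξ : ℝ} (hξ : 0 < ξ) {F : Finset (ℕ →₀ ℕ)}
    (hF : ∀ s, s ∈ F ↔ s ∈ LambdaSet q ρ ξ) {φ : (ℕ →₀ ℕ) → ℝ} {δ : ℝ} (hδ : 0 ≤ δ)
    (hφ : ∀ s ∈ F, |φ s - sigmaWeight y s| ≤ δ) :
    ‖u y - ∑ s ∈ F, φ s • taylorCoeff u s‖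
      ≤ √(1 - θ)⁻¹ * (‖f‖ / α) * √(∑' s, (sigmaWeight ρ s ^ q)⁻¹) *
        (ξ ^ (-(1 / q - 1 / 2)) + δ) := by
  have hρ0 : ∀ j, 0 < ρ j := fun j => zero_lt_one.trans (hρ_one j)
  have hpos : ∀ s, 0 < sigmaWeight ρ s := sigmaWeight_pos hρ0
  have hcoer : IsCoercive a := ⟨α, hα, fun v => by rw [mul_assoc, ← sq]; exact ha v⟩
  obtain ⟨τ, hτ⟩ := exists_isTaylorRecursion hcoer (fun j => ρ j • b j) f
  set t : (ℕ →₀ ℕ) → V := fun s => (sigmaWeight ρ s)⁻¹ • τ s with ht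
  set E := √(1 - θ)⁻¹ * (‖f‖ / α) with hE
  have hE0 : 0 ≤ E := by positivity
  have htτ : ∀ s, sigmaWeight ρ s • t s = τ s := fun s => by
    rw [ht, smul_smul, mul_inv_cancel₀ (hpos s).ne', one_smul]
  have hsq : ∀ G : Finset (ℕ →₀ ℕ), ∑ s ∈ G, ‖sigmaWeight ρ s • t s‖ ^ 2 ≤ E ^ 2 := by
    intro G
    simp_rw [htτ]
    rw [hE, mul_pow, Real.sq_sqrt (inv_nonneg.2 (by linarith))]
    exact sum_norm_sq_le hα ha hθ0 hθ1 hb hτ G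
  have hsumm := summable_norm_of_sum_sq_le hq2 hρ_one hs hE0 hsq
  have hsol : ∀ y : ℕ → ℝ, (∀ j, |y j| ≤ 1) → u y = ∑' s, sigmaWeight y s • t s := by
    intro y hy
    set z : ℕ → ℝ := fun j => y j * (ρ j)⁻¹ with hz
    have hz1 : ∀ j, |z j| ≤ 1 := by
      intro j
      rw [hz, abs_mul, abs_of_pos (inv_pos.2 (hρ0 j))]
      exact mul_le_one₀ (hy j) (inv_pos.2 (hρ0 j)).le (inv_le_one_of_one_le₀ (hρ_one j).le)
    have hzs : ∀ s, sigmaWeight z s • τ s = sigmaWeight y s • t s := by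
      intro s
      rw [hz, sigmaWeight_mul, sigmaWeight_inv, mul_smul]
    have hzb : ∀ j v w, z j * (ρ j • b j) v w = y j * b j v w := by
      intro j v w
      simp only [hz, smul_apply, smul_eq_mul]
      field_simp [(hρ0 j).ne']
    have hzsum : Summable fun s => ‖sigmaWeight z s • τ s‖ := by
      refine Summable.of_nonneg_of_le (fun s => norm_nonneg _) (fun s => ?_) hsumm
      rw [hzs, norm_smul]
      exact mul_le_of_le_one_left (norm_nonneg _) (abs_sigmaWeight_le_one hy s)
    simp_rw [← hzs]
    refine hb.eq_of_hasSum hα ha hθ1 hz1 (f := f) (fun w => ?_)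
      (hasSum_powerSeries_apply hb hθ0 hτ hz1 hzsum)
    simp only [hzb]
    exact hu y hy w
  have htay : ∀ s, taylorCoeff u s = t s :=
    (hasExpansion_of_summable hsumm fun y hy => hsol y fun j => (hy j).le).taylorCoeff_eq
  simp_rw [htay]
  rw [hsol y hy]
  exact norm_sub_sum_le hq0 hq2 hρ_one hs hE0 hsq hy hξ hF hδ hφ

end Parametric

section Poincare

variable {d : ℕ}

theorem norm_gradient_eq (φ : EuclideanSpace ℝ (Fin d) → ℝ) (x : EuclideanSpace ℝ (Fin d)) :
    ‖gradient φ x‖ = ‖fderiv ℝ φ x‖ := by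
  simp [gradient]

theorem continuous_gradient_of_contDiff {φ : EuclideanSpace ℝ (Fin d) → ℝ}
    (hφ : ContDiff ℝ ∞ φ) : Continuous (gradient φ) :=
  (InnerProductSpace.toDual ℝ _).symm.continuous.comp (hφ.continuous_fderiv (by simp))

/-- The Poincaré inequality for functions supported in a ball. -/
theorem integral_sq_le_integral_gradient_sq (hd : 0 < d) {φ : EuclideanSpace ℝ (Fin d) → ℝ}
    (hφ : ContDiff ℝ ∞ φ) (hc : HasCompactSupport φ) {R : ℝ}
    (hR : ∀ x, φ x ≠ 0 → ‖x‖ ≤ R) :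
    ∫ x, φ x ^ 2 ≤ 4 * R ^ 2 * ∫ x, ‖gradient φ x‖ ^ 2 := by
  set i : Fin d := ⟨0, hd⟩
  set v : EuclideanSpace ℝ (Fin d) := EuclideanSpace.single i 1 with hv
  set g : EuclideanSpace ℝ (Fin d) →L[ℝ] ℝ := EuclideanSpace.proj i with hg
  have hvn : ‖v‖ = 1 := by simp [hv]
  have hgv : ∀ x, fderiv ℝ g x v = 1 := fun x => by
    rw [g.fderiv]
    simp [hg, hv]
  have hφc := hφ.continuous
  have hφd : Differentiable ℝ φ := hφ.differentiable (by simp)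
  have hsq : ∀ x, fderiv ℝ (fun x => φ x ^ 2) x v = 2 * φ x * fderiv ℝ φ x v := fun x => by
    rw [((hφd x).hasFDerivAt.pow 2).fderiv]
    simp
  have hdc : Continuous fun x => fderiv ℝ φ x v :=
    (hφ.continuous_fderiv (by simp)).clm_apply continuous_const
  have hsqint : Integrable fun x => φ x ^ 2 :=
    (hφc.pow 2).integrable_of_hasCompactSupport (by
      simpa only [sq] using hc.mul_right (f' := φ))
  have hgint : Integrable fun x => ‖gradient φ x‖ ^ 2 := by
    refine ((continuous_gradient_of_contDiff hφ).norm.pow 2).integrable_of_hasCompactSupport ?_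
    simp_rw [norm_gradient_eq, sq]
    exact ((hc.fderiv (𝕜 := ℝ)).norm).mul_right
  have hI : Integrable fun x => 2 * φ x * fderiv ℝ φ x v * g x := by
    refine Continuous.integrable_of_hasCompactSupport
      (((continuous_const.mul hφc).mul hdc).mul g.continuous) ?_
    exact ((hc.mul_left (f := fun _ => (2 : ℝ))).mul_right).mul_right
  have h1 := integral_mul_fderiv_eq_neg_fderiv_mul_of_integrable (μ := volume)
    (f := fun x => φ x ^ 2) (g := g) (v := v) ?_ ?_ ?_
    (fun x _ => (hφd x).pow 2) (fun x _ => g.differentiableAt)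
  · simp only [hgv, mul_one, hsq] at h1
    have h2 : ∀ x, -(2 * φ x * fderiv ℝ φ x v * g x)
        ≤ φ x ^ 2 / 2 + 2 * R ^ 2 * ‖gradient φ x‖ ^ 2 := by
      intro x
      by_cases h0 : φ x = 0
      · rw [h0]; simp; positivity
      have h3 : |g x| ≤ R := (by simpa [hg] using PiLp.norm_apply_le x i : |g x| ≤ ‖x‖).trans (hR x h0)
      have h4 : |fderiv ℝ φ x v| ≤ ‖gradient φ x‖ := by
        rw [norm_gradient_eq]
        simpa [hvn] using (fderiv ℝ φ x).le_opNorm v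
      have h5 : |fderiv ℝ φ x v * g x| ≤ ‖gradient φ x‖ * R := by
        rw [abs_mul]
        exact mul_le_mul h4 h3 (abs_nonneg _) (norm_nonneg _)
      have h6 : (fderiv ℝ φ x v * g x) ^ 2 ≤ (‖gradient φ x‖ * R) ^ 2 := by
        rw [← sq_abs]
        exact pow_le_pow_left₀ (abs_nonneg _) h5 2
      nlinarith [sq_nonneg (φ x + 2 * (fderiv ℝ φ x v * g x))]
    have h3 : ∫ x, φ x ^ 2 ≤ ∫ x, (φ x ^ 2 / 2 + 2 * R ^ 2 * ‖gradient φ x‖ ^ 2) := by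
      rw [h1, ← integral_neg]
      exact integral_mono hI.neg ((hsqint.div_const 2).add (hgint.const_mul _)) h2
    rw [integral_add (hsqint.div_const 2) (hgint.const_mul _), integral_div,
      integral_const_mul] at h3
    linarith
  · simpa only [hsq] using hI
  · simpa only [hgv, mul_one] using hsqint
  · refine ((hφc.pow 2).mul g.continuous).integrable_of_hasCompactSupport ?_
    simpa only [sq] using (hc.mul_right (f' := φ)).mul_right (f' := g)

theorem add_mem_testPairs {D : Set (EuclideanSpace ℝ (Fin d))} {p r : GradPair D}
    (hp : p ∈ testPairs D) (hr : r ∈ testPairs D) : p + r ∈ testPairs D := by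
  obtain ⟨φ, h1, h2, h3, h4, h5⟩ := hp
  obtain ⟨χ, k1, k2, k3, k4, k5⟩ := hr
  refine ⟨φ + χ, h1.add k1, h2.add k2, ?_, ?_, ?_⟩
  · exact (tsupport_add φ χ).trans (Set.union_subset h3 k3)
  · filter_upwards [h4, k4, Lp.coeFn_add p.fst r.fst] with x hx hx' hx''
    rw [WithLp.add_fst, hx'', Pi.add_apply, hx, hx', Pi.add_apply]
  · filter_upwards [h5, k5, Lp.coeFn_add p.snd r.snd] with x hx hx' hx''
    rw [WithLp.add_snd, hx'', Pi.add_apply, hx, hx']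
    simp only [gradient]
    rw [fderiv_add (h1.differentiable (by simp) x) (k1.differentiable (by simp) x), map_add]

theorem smul_mem_testPairs {D : Set (EuclideanSpace ℝ (Fin d))} {p : GradPair D}
    (hp : p ∈ testPairs D) (c : ℝ) : c • p ∈ testPairs D := by
  obtain ⟨φ, h1, h2, h3, h4, h5⟩ := hp
  refine ⟨c • φ, contDiff_const.smul h1, h2.smul_left (f := fun _ => c), ?_, ?_, ?_⟩
  · exact (tsupport_smul_subset_right (fun _ => c) φ).trans h3
  · filter_upwards [h4, Lp.coeFn_smul c p.fst] with x hx hx'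
    rw [WithLp.smul_fst, hx', Pi.smul_apply, hx, Pi.smul_apply]
  · filter_upwards [h5, Lp.coeFn_smul c p.snd] with x hx hx'
    rw [WithLp.smul_snd, hx', Pi.smul_apply, hx]
    simp only [gradient]
    rw [fderiv_const_smul (h1.differentiable (by simp) x)]
    simp

theorem zero_mem_testPairs (D : Set (EuclideanSpace ℝ (Fin d))) : (0 : GradPair D) ∈ testPairs D := by
  refine ⟨0, contDiff_const, HasCompactSupport.zero, by simp, ?_, ?_⟩
  · filter_upwards [Lp.coeFn_zero ℝ 2 (volume.restrict D)] with x hx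
    rw [WithLp.zero_fst, hx]
  · filter_upwards [Lp.coeFn_zero (EuclideanSpace ℝ (Fin d)) 2 (volume.restrict D)] with x hx
    rw [WithLp.zero_snd, hx]
    simp [gradient]

theorem Lp_norm_sq_eq_integral {α F : Type*} [MeasurableSpace α] {μ : Measure α}
    [NormedAddCommGroup F] [InnerProductSpace ℝ F] (g : Lp F 2 μ) :
    ‖g‖ ^ 2 = ∫ x, ‖g x‖ ^ 2 ∂μ := by
  rw [← real_inner_self_eq_norm_sq, L2.inner_def]
  simp_rw [real_inner_self_eq_norm_sq]

theorem norm_fst_sq_le_of_mem_testPairs (hd : 0 < d) {D : Set (EuclideanSpace ℝ (Fin d))} {R : ℝ}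
    (hR : ∀ x ∈ D, ‖x‖ ≤ R) {p : GradPair D} (hp : p ∈ testPairs D) :
    ‖p.fst‖ ^ 2 ≤ 4 * R ^ 2 * ‖p.snd‖ ^ 2 := by
  obtain ⟨φ, h1, h2, h3, h4, h5⟩ := hp
  have hout : ∀ x, x ∉ D → x ∉ tsupport φ := fun x hx h => hx (h3 h)
  have e1 : ‖p.fst‖ ^ 2 = ∫ x, φ x ^ 2 := by
    rw [Lp_norm_sq_eq_integral, ← setIntegral_eq_integral_of_forall_compl_eq_zero (s := D)
      (f := fun x => φ x ^ 2)]
    · refine integral_congr_ae ?_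
      filter_upwards [h4] with x hx
      rw [hx, Real.norm_eq_abs, sq_abs]
    · intro x hx
      simp [image_eq_zero_of_notMem_tsupport (hout x hx)]
  have e2 : ‖p.snd‖ ^ 2 = ∫ x, ‖gradient φ x‖ ^ 2 := by
    rw [Lp_norm_sq_eq_integral, ← setIntegral_eq_integral_of_forall_compl_eq_zero (s := D)
      (f := fun x => ‖gradient φ x‖ ^ 2)]
    · refine integral_congr_ae ?_
      filter_upwards [h5] with x hx
      rw [hx]
    · intro x hx
      have : fderiv ℝ φ x = 0 :=
        image_eq_zero_of_notMem_tsupport fun h => hout x hx (tsupport_fderiv_subset ℝ h)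
      simp [norm_gradient_eq, this]
  rw [e1, e2]
  exact integral_sq_le_integral_gradient_sq hd h1 h2 fun x hx =>
    hR x (h3 (subset_tsupport φ hx))

theorem norm_sq_le_weakGrad (hd : 0 < d) {D : Set (EuclideanSpace ℝ (Fin d))} {R : ℝ}
    (hR : ∀ x ∈ D, ‖x‖ ≤ R) (v : H10 D) : ‖v‖ ^ 2 ≤ (4 * R ^ 2 + 1) * ‖weakGrad v‖ ^ 2 := by
  have hspan : ∀ p ∈ Submodule.span ℝ (testPairs D), p ∈ testPairs D := fun p hp =>
    Submodule.span_induction (fun _ h => h) (zero_mem_testPairs D)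
      (fun _ _ _ _ => add_mem_testPairs) (fun c _ _ h => smul_mem_testPairs h c) hp
  have hclosed : IsClosed {p : GradPair D | ‖p.fst‖ ^ 2 ≤ 4 * R ^ 2 * ‖p.snd‖ ^ 2} :=
    isClosed_le (by fun_prop) (by fun_prop)
  have hv : (v : GradPair D) ∈ {p : GradPair D | ‖p.fst‖ ^ 2 ≤ 4 * R ^ 2 * ‖p.snd‖ ^ 2} := by
    refine closure_minimal (fun p hp => ?_) hclosed v.2
    exact norm_fst_sq_le_of_mem_testPairs hd hR (hspan p hp)
  have h1 : ‖v‖ ^ 2 = ‖(v : GradPair D).fst‖ ^ 2 + ‖(v : GradPair D).snd‖ ^ 2 := by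
    rw [← WithLp.prod_norm_sq_eq_of_L2]
    rfl
  have h2 : ‖(v : GradPair D).fst‖ ^ 2 ≤ 4 * R ^ 2 * ‖(v : GradPair D).snd‖ ^ 2 := hv
  have h3 : weakGrad v = (v : GradPair D).snd := rfl
  rw [h1, h3]
  linarith

end Poincare

section Forms

variable {d : ℕ} {D : Set (EuclideanSpace ℝ (Fin d))}

/-- The weak gradient as a continuous linear map. -/
noncomputable def weakGradL (D : Set (EuclideanSpace ℝ (Fin d))) :
    H10 D →L[ℝ] Lp (EuclideanSpace ℝ (Fin d)) 2 (volume.restrict D) :=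
  (WithLp.sndL 2 ℝ _ _).comp (H10 D).subtypeL

/-- Multiplication by a bounded function. -/
noncomputable def mulLp {ψ : EuclideanSpace ℝ (Fin d) → ℝ} (hψ : MemLp ψ ∞ (volume.restrict D)) :
    Lp (EuclideanSpace ℝ (Fin d)) 2 (volume.restrict D) →L[ℝ]
      Lp (EuclideanSpace ℝ (Fin d)) 2 (volume.restrict D) :=
  (ContinuousLinearMap.lsmul ℝ ℝ).holderL (volume.restrict D) ∞ 2 2 (hψ.toLp ψ)

theorem coeFn_mulLp {ψ : EuclideanSpace ℝ (Fin d) → ℝ} (hψ : MemLp ψ ∞ (volume.restrict D))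
    (g : Lp (EuclideanSpace ℝ (Fin d)) 2 (volume.restrict D)) :
    mulLp hψ g =ᵐ[volume.restrict D] fun x => ψ x • g x := by
  have h := ContinuousLinearMap.coeFn_holder (r := 2)
    (ContinuousLinearMap.lsmul ℝ ℝ) (hψ.toLp ψ) g
  filter_upwards [h, hψ.coeFn_toLp] with x hx hx'
  rw [← hx']
  exact hx

/-- The bilinear form `(v, w) ↦ ∫ ψ ∇v · ∇w`. -/
noncomputable def gradForm {ψ : EuclideanSpace ℝ (Fin d) → ℝ}
    (hψ : MemLp ψ ∞ (volume.restrict D)) : H10 D →L[ℝ] H10 D →L[ℝ] ℝ :=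
  (innerSL ℝ).bilinearComp ((mulLp hψ).comp (weakGradL D)) (weakGradL D)

theorem gradForm_apply {ψ : EuclideanSpace ℝ (Fin d) → ℝ} (hψ : MemLp ψ ∞ (volume.restrict D))
    (v w : H10 D) :
    gradForm hψ v w = ∫ x in D, ψ x * inner ℝ (weakGrad v x) (weakGrad w x) := by
  change inner ℝ (mulLp hψ (weakGrad v)) (weakGrad w) = _
  rw [L2.inner_def]
  refine integral_congr_ae ?_
  filter_upwards [coeFn_mulLp hψ (weakGrad v)] with x hx
  rw [hx, real_inner_smul_left]

theorem integrable_mul_inner {ψ : EuclideanSpace ℝ (Fin d) → ℝ}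
    (hψ : MemLp ψ ∞ (volume.restrict D))
    (g h : Lp (EuclideanSpace ℝ (Fin d)) 2 (volume.restrict D)) :
    Integrable (fun x => ψ x * inner ℝ (g x) (h x)) (volume.restrict D) := by
  refine (L2.integrable_inner (𝕜 := ℝ) (mulLp hψ g) h).congr ?_
  filter_upwards [coeFn_mulLp hψ g] with x hx
  rw [hx, real_inner_smul_left]

theorem integrable_mul_norm_sq {ψ : EuclideanSpace ℝ (Fin d) → ℝ}
    (hψ : MemLp ψ ∞ (volume.restrict D))
    (g : Lp (EuclideanSpace ℝ (Fin d)) 2 (volume.restrict D)) :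
    Integrable (fun x => ψ x * ‖g x‖ ^ 2) (volume.restrict D) := by
  simpa only [real_inner_self_eq_norm_sq] using integrable_mul_inner hψ g g

theorem gradForm_coercive (hd : 0 < d) {R : ℝ} (hR : ∀ x ∈ D, ‖x‖ ≤ R)
    {abar : EuclideanSpace ℝ (Fin d) → ℝ} (ha : MemLp abar ∞ (volume.restrict D)) {α : ℝ}
    (hα : 0 < α) (haα : ∀ᵐ x ∂(volume.restrict D), α ≤ abar x) (v : H10 D) :
    α / (4 * R ^ 2 + 1) * ‖v‖ ^ 2 ≤ gradForm ha v v := by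
  have h1 := norm_sq_le_weakGrad hd hR v
  have h2 : α * ‖weakGrad v‖ ^ 2 ≤ gradForm ha v v := by
    rw [gradForm_apply, Lp_norm_sq_eq_integral, ← integral_const_mul]
    simp_rw [real_inner_self_eq_norm_sq]
    refine integral_mono_ae ?_ (integrable_mul_norm_sq ha _) ?_
    · have h3 := (L2.integrable_inner (𝕜 := ℝ) (weakGrad v) (weakGrad v)).const_mul α
      simpa only [real_inner_self_eq_norm_sq] using h3
    · filter_upwards [haα] with x hx
      exact mul_le_mul_of_nonneg_right hx (sq_nonneg _)
  refine le_trans ?_ h2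
  rw [div_mul_eq_mul_div, div_le_iff₀ (by positivity)]
  calc α * ‖v‖ ^ 2 ≤ α * ((4 * R ^ 2 + 1) * ‖weakGrad v‖ ^ 2) :=
        mul_le_mul_of_nonneg_left h1 hα.le
    _ = _ := by ring

theorem ae_sum_le_of_essSup_le {ρ : ℕ → ℝ} (hρ : ∀ j, 0 ≤ ρ j)
    {abar : EuclideanSpace ℝ (Fin d) → ℝ} {ψ : ℕ → EuclideanSpace ℝ (Fin d) → ℝ} {α θ : ℝ}
    (hα : 0 < α) (haα : ∀ᵐ x ∂(volume.restrict D), α ≤ abar x)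
    (hθ : essSup (fun x => (∑' j, ENNReal.ofReal (ρ j * |ψ j x|)) / ENNReal.ofReal (abar x))
      (volume.restrict D) ≤ ENNReal.ofReal θ) :
    ∀ᵐ x ∂(volume.restrict D), ∀ F : Finset ℕ,
      ∑ j ∈ F, ρ j * |ψ j x| ≤ max θ 0 * abar x := by
  filter_upwards [haα, ENNReal.ae_le_essSup
    (fun x => (∑' j, ENNReal.ofReal (ρ j * |ψ j x|)) / ENNReal.ofReal (abar x))] with x hx hx' F
  have h0 : 0 < abar x := hα.trans_le hx
  have h1 := hx'.trans hθ
  rw [ENNReal.div_le_iff (ENNReal.ofReal_pos.2 h0).ne' ENNReal.ofReal_ne_top] at h1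
  have h2 : ENNReal.ofReal (∑ j ∈ F, ρ j * |ψ j x|) ≤ ENNReal.ofReal (max θ 0 * abar x) := by
    rw [ENNReal.ofReal_sum_of_nonneg fun j _ => mul_nonneg (hρ j) (abs_nonneg _),
      ENNReal.ofReal_mul (le_max_right _ _)]
    refine (ENNReal.sum_le_tsum F).trans (h1.trans ?_)
    gcongr
    exact le_max_left _ _
  exact (ENNReal.ofReal_le_ofReal_iff (mul_nonneg (le_max_right _ _) h0.le)).1 h2

theorem gradForm_isDominated {ρ : ℕ → ℝ} (hρ : ∀ j, 0 ≤ ρ j)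
    {abar : EuclideanSpace ℝ (Fin d) → ℝ} {ψ : ℕ → EuclideanSpace ℝ (Fin d) → ℝ} {θ : ℝ}
    (ha : MemLp abar ∞ (volume.restrict D)) (hψ : ∀ j, MemLp (ψ j) ∞ (volume.restrict D))
    (hθ : ∀ᵐ x ∂(volume.restrict D), ∀ F : Finset ℕ,
      ∑ j ∈ F, ρ j * |ψ j x| ≤ θ * abar x) :
    IsDominated (gradForm ha) (fun j => ρ j • gradForm (hψ j))
      (fun j v => ∫ x in D, ρ j * |ψ j x| * ‖weakGrad v x‖ ^ 2) θ := by
  have hint : ∀ j (v : H10 D), Integrable (fun x => ρ j * |ψ j x| * ‖weakGrad v x‖ ^ 2)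
      (volume.restrict D) := fun j v =>
    integrable_mul_norm_sq (((hψ j).norm).const_mul (ρ j)) (weakGrad v)
  refine ⟨fun j v => integral_nonneg fun x => ?_, fun j v w => ?_, fun F v => ?_⟩
  · exact mul_nonneg (mul_nonneg (hρ j) (abs_nonneg _)) (sq_nonneg _)
  · rw [smul_apply, smul_apply, smul_eq_mul, gradForm_apply, ← integral_const_mul,
      ← integral_add (hint j v) (hint j w), ← integral_div, ← Real.norm_eq_abs]
    refine norm_integral_le_of_norm_le (((hint j v).add (hint j w)).div_const 2)
      (Filter.Eventually.of_forall fun x => ?_)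
    rw [Real.norm_eq_abs, abs_mul, abs_mul, abs_of_nonneg (hρ j), ← mul_assoc]
    have h1 := abs_real_inner_le_norm (weakGrad v x) (weakGrad w x)
    have h2 : |inner ℝ (weakGrad v x) (weakGrad w x)|
        ≤ (‖weakGrad v x‖ ^ 2 + ‖weakGrad w x‖ ^ 2) / 2 := by
      nlinarith [sq_nonneg (‖weakGrad v x‖ - ‖weakGrad w x‖)]
    calc _ ≤ ρ j * |ψ j x| * ((‖weakGrad v x‖ ^ 2 + ‖weakGrad w x‖ ^ 2) / 2) :=
          mul_le_mul_of_nonneg_left h2 (mul_nonneg (hρ j) (abs_nonneg _))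
      _ = _ := by ring
  · rw [← integral_finsetSum F fun j _ => hint j v, gradForm_apply, ← integral_const_mul]
    refine integral_mono_ae (integrable_finsetSum F fun j _ => hint j v)
      ((integrable_mul_inner ha _ _).const_mul θ) ?_
    filter_upwards [hθ] with x hx
    rw [← Finset.sum_mul, real_inner_self_eq_norm_sq, ← mul_assoc]
    exact mul_le_mul_of_nonneg_right (hx F) (sq_nonneg _)

set_option maxHeartbeats 1000000 in
theorem hasSum_gradForm_of_isWeakSolution {abar : EuclideanSpace ℝ (Fin d) → ℝ}
    {ψ : ℕ → EuclideanSpace ℝ (Fin d) → ℝ} {θ : ℝ} (hθ0 : 0 ≤ θ)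
    (ha : MemLp abar ∞ (volume.restrict D)) (hψ : ∀ j, MemLp (ψ j) ∞ (volume.restrict D))
    (hθ : ∀ᵐ x ∂(volume.restrict D), ∀ F : Finset ℕ, ∑ j ∈ F, |ψ j x| ≤ θ * abar x)
    {y : ℕ → ℝ} (hy : ∀ j, |y j| ≤ 1) {f : H10 D →L[ℝ] ℝ} {u : H10 D}
    (hu : IsWeakSolution (affineCoeff abar ψ y) f u) (w : H10 D) :
    HasSum (fun j => y j * gradForm (hψ j) u w) (f w - gradForm ha u w) := by
  set g : EuclideanSpace ℝ (Fin d) → ℝ := fun x => inner ℝ (weakGrad u x) (weakGrad w x) with hg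
  have hint : ∀ {χ : EuclideanSpace ℝ (Fin d) → ℝ}, MemLp χ ∞ (volume.restrict D) →
      Integrable (fun x => χ x * g x) (volume.restrict D) := fun hχ => integrable_mul_inner hχ _ _
  set G : ℕ → EuclideanSpace ℝ (Fin d) → ℝ := fun j x => y j * ψ j x * g x with hG
  have hGint : ∀ j, Integrable (G j) (volume.restrict D) := fun j => hint ((hψ j).const_mul (y j))
  have hGle : ∀ j x, ‖G j x‖ ≤ |ψ j x| * |g x| := by
    intro j x
    rw [Real.norm_eq_abs, abs_mul, abs_mul]
    exact mul_le_mul_of_nonneg_right (mul_le_of_le_one_left (abs_nonneg _) (hy j)) (abs_nonneg _)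
  have hbd : ∀ᵐ x ∂(volume.restrict D), ∀ F : Finset ℕ, ∑ j ∈ F, ‖G j x‖ ≤ θ * ‖abar x * g x‖ := by
    filter_upwards [hθ] with x hx F
    refine (Finset.sum_le_sum fun j _ => hGle j x).trans ?_
    rw [← Finset.sum_mul, norm_mul, ← mul_assoc]
    exact mul_le_mul_of_nonneg_right ((hx F).trans
      (mul_le_mul_of_nonneg_left (le_abs_self _) hθ0)) (abs_nonneg _)
  have hsum : HasSum (fun j => ∫ x in D, G j x) (∫ x in D, ∑' j, G j x) := by
    refine hasSum_integral_of_summable_integral_norm hGint ?_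
    refine summable_of_sum_le (c := ∫ x in D, θ * ‖abar x * g x‖)
      (fun j => integral_nonneg fun x => norm_nonneg _) fun F => ?_
    rw [← integral_finsetSum F fun j _ => (hGint j).norm]
    refine integral_mono_ae (integrable_finsetSum F fun j _ => (hGint j).norm)
      ((hint ha).norm.const_mul θ) ?_
    filter_upwards [hbd] with x hx
    exact hx F
  have htint : Integrable (fun x => ∑' j, G j x) (volume.restrict D) := by
    refine Integrable.mono' ((hint ha).norm.const_mul θ) ?_ ?_
    · refine aestronglyMeasurable_of_tendsto_ae Filter.atTop
        (f := fun n x => ∑ j ∈ Finset.range n, G j x)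
        (fun n => (integrable_finsetSum _ fun j _ => hGint j).aestronglyMeasurable) ?_
      filter_upwards [hbd] with x hx
      exact (Summable.of_norm
        (summable_of_sum_le (fun j => norm_nonneg _) hx)).hasSum.tendsto_sum_nat
    · filter_upwards [hbd] with x hx
      exact tsum_of_norm_bounded
        (summable_of_sum_le (fun j => norm_nonneg _) hx).hasSum (fun j => le_rfl)
        |>.trans (Real.tsum_le_of_sum_le (fun j => norm_nonneg _) hx)
  have h1 : f w = gradForm ha u w + ∫ x in D, ∑' j, G j x := by
    rw [← hu w, gradForm_apply, ← integral_add (hint ha) htint]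
    refine integral_congr_ae (Filter.Eventually.of_forall fun x => ?_)
    simp only [affineCoeff, hG, add_mul, tsum_mul_right, hg]
  have h2 : ∀ j, y j * gradForm (hψ j) u w = ∫ x in D, G j x := by
    intro j
    rw [gradForm_apply, ← integral_const_mul]
    simp only [hG, hg, mul_assoc]
  simp only [h2]
  rwa [h1, add_sub_cancel_left]

end Forms

namespace ReLUNetwork

/-- The network whose neuron `k` in layer `ℓ + 1` has the incoming connections listed in
`conn ℓ k`; an entry `(i, p, c)` is a connection with weight `c` from neuron `p` of layer `i`. -/
noncomputable def ofLists (H : ℕ) (hH : 1 ≤ H) (width : ℕ → ℕ) (hw : ∀ ℓ, ℓ ≤ H + 1 → 0 < width ℓ)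
    (conn : ℕ → ℕ → List (ℕ × ℕ × ℝ)) (b : ℕ → ℕ → ℝ) : ReLUNetwork where
  hiddenLayers := H
  one_le_hiddenLayers := hH
  width := width
  width_pos := hw
  weight ℓ k p := ((conn ℓ k).map fun e =>
    if e.1 = (p.1 : ℕ) ∧ e.2.1 = (p.2 : ℕ) then e.2.2 else 0).sum
  bias ℓ k := b ℓ k

/-- The value of neuron `k` of layer `ℓ`, and `0` if there is none. -/
noncomputable def val (Φ : ReLUNetwork) (x : Fin (Φ.width 0) → ℝ) (ℓ k : ℕ) : ℝ :=
  if h : k < Φ.width ℓ then Φ.neurons x ℓ ⟨k, h⟩ else 0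

theorem val_coe (Φ : ReLUNetwork) (x : Fin (Φ.width 0) → ℝ) (ℓ : ℕ) (k : Fin (Φ.width ℓ)) :
    Φ.val x ℓ k = Φ.neurons x ℓ k := by
  simp [val]

theorem realize_eq_val (Φ : ReLUNetwork) (x : Fin Φ.inDim → ℝ) (k : Fin Φ.outDim) :
    Φ.realize x k = (∑ p : (Σ i : Fin (Φ.hiddenLayers + 1), Fin (Φ.width i)),
      Φ.weight Φ.hiddenLayers k p * Φ.val x p.1 p.2) + Φ.bias Φ.hiddenLayers k := by
  rw [realize]
  congr 1
  exact Finset.sum_congr rfl fun p _ => congrArg _ (val_coe Φ x p.1 p.2).symm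

theorem val_zero (Φ : ReLUNetwork) (y : ℕ → ℝ) {k : ℕ} (hk : k < Φ.width 0) :
    Φ.val (fun i => y i) 0 k = y k := by
  simp [val, hk, neurons]

theorem sum_listWeight_mul (ℓ : ℕ) (width : ℕ → ℕ) (L : List (ℕ × ℕ × ℝ))
    (hL : ∀ e ∈ L, e.1 ≤ ℓ ∧ e.2.1 < width e.1) (v : ℕ → ℕ → ℝ) :
    ∑ p : (Σ i : Fin (ℓ + 1), Fin (width i)), (L.map fun e =>
      if e.1 = (p.1 : ℕ) ∧ e.2.1 = (p.2 : ℕ) then e.2.2 else 0).sum * v p.1 p.2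
      = (L.map fun e => e.2.2 * v e.1 e.2.1).sum := by
  induction L with
  | nil => simp
  | cons e L ih =>
    simp only [List.map_cons, List.sum_cons, add_mul, Finset.sum_add_distrib]
    rw [ih fun e' he' => hL e' (by simp [he'])]
    congr 1
    obtain ⟨h1, h2⟩ := hL e (by simp)
    rw [Finset.sum_eq_single
      (⟨⟨e.1, Nat.lt_succ_of_le h1⟩, ⟨e.2.1, h2⟩⟩ : Σ i : Fin (ℓ + 1), Fin (width i))]
    · simp
    · rintro ⟨⟨i, hi⟩, ⟨p, hp⟩⟩ _ hne
      rw [if_neg, zero_mul]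
      rintro ⟨rfl, rfl⟩
      exact hne rfl
    · simp

variable {H : ℕ} {hH : 1 ≤ H} {width : ℕ → ℕ} {hw : ∀ ℓ, ℓ ≤ H + 1 → 0 < width ℓ}
  {conn : ℕ → ℕ → List (ℕ × ℕ × ℝ)} {b : ℕ → ℕ → ℝ}

theorem ofLists_val_succ (x : Fin ((ofLists H hH width hw conn b).width 0) → ℝ) {ℓ k : ℕ}
    (hk : k < width (ℓ + 1)) (hL : ∀ e ∈ conn ℓ k, e.1 ≤ ℓ ∧ e.2.1 < width e.1) :
    (ofLists H hH width hw conn b).val x (ℓ + 1) k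
      = max (((conn ℓ k).map fun e =>
          e.2.2 * (ofLists H hH width hw conn b).val x e.1 e.2.1).sum + b ℓ k) 0 := by
  have hk' : k < (ofLists H hH width hw conn b).width (ℓ + 1) := hk
  rw [← sum_listWeight_mul ℓ width _ hL, val, dif_pos hk', neurons]
  simp only [← val_coe]
  rfl

theorem ofLists_realize (x : Fin (ofLists H hH width hw conn b).inDim → ℝ)
    (k : Fin (ofLists H hH width hw conn b).outDim)
    (hL : ∀ e ∈ conn H k, e.1 ≤ H ∧ e.2.1 < width e.1) :
    (ofLists H hH width hw conn b).realize x k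
      = ((conn H k).map fun e =>
          e.2.2 * (ofLists H hH width hw conn b).val x e.1 e.2.1).sum + b H k := by
  rw [realize_eq_val, ← sum_listWeight_mul H width _ hL]
  rfl

theorem ofLists_size_le :
    (ofLists H hH width hw conn b).size ≤ ∑ ℓ ∈ Finset.range (H + 1),
      ∑ k ∈ Finset.range (width (ℓ + 1)), ((conn ℓ k).length + if b ℓ k = 0 then 0 else 1) := by
  classical
  refine Finset.sum_le_sum fun ℓ _ => ?_
  rw [Finset.sum_add_distrib]
  refine add_le_add ?_ ?_
  · rw [Nat.card_eq_fintype_card, Fintype.card_subtype]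
    calc _ ≤ (Finset.univ.sigma fun k : Fin (width (ℓ + 1)) =>
          ((conn ℓ k).map fun e => (e.1, e.2.1)).toFinset).card := by
          refine Finset.card_le_card_of_injOn (fun p => ⟨p.1, (p.2.1, p.2.2)⟩) ?_ ?_
          · rintro ⟨k, i, p⟩ hp
            have hp' := (Finset.mem_filter.1 hp).2
            have hex : ∃ e ∈ conn ℓ k, e.1 = (i : ℕ) ∧ e.2.1 = (p : ℕ) := by
              by_contra hc
              push Not at hc
              refine hp' (List.sum_eq_zero fun c hc' => ?_)
              obtain ⟨e, he, rfl⟩ := List.mem_map.1 hc'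
              exact if_neg fun h => hc e he h.1 h.2
            obtain ⟨e, he, h1, h2⟩ := hex
            exact Finset.mem_coe.2 (Finset.mem_sigma.2 ⟨Finset.mem_univ _,
              List.mem_toFinset.2 (List.mem_map.2 ⟨e, he, by rw [h1, h2]⟩)⟩)
          · rintro ⟨k, ⟨i, hi⟩, ⟨p, hp⟩⟩ _ ⟨k', ⟨i', hi'⟩, ⟨p', hp'⟩⟩ _ h
            cases h
            rfl
      _ = ∑ k : Fin (width (ℓ + 1)), (((conn ℓ k).map fun e => (e.1, e.2.1)).toFinset).card :=
          Finset.card_sigma _ _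
      _ ≤ ∑ k : Fin (width (ℓ + 1)), (conn ℓ k).length :=
          Finset.sum_le_sum fun k _ => (List.toFinset_card_le _).trans (by simp)
      _ = _ := Fin.sum_univ_eq_sum_range (fun k => (conn ℓ k).length) _
  · rw [Nat.card_eq_fintype_card, Fintype.card_subtype, Finset.card_filter,
      ← Fin.sum_univ_eq_sum_range (fun k => if b ℓ k = 0 then 0 else 1)]
    refine le_of_eq (Finset.sum_congr rfl fun k _ => ?_)
    simp only [ne_eq, ite_not]
    rfl

end ReLUNetwork

/-- Yarotsky's piecewise linear interpolation of `z ↦ z ^ 2` on `[0, 1]`. -/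
noncomputable def sqApprox : ℕ → ℝ → ℝ
  | 0, z => z
  | m + 1, z => z - 1 / 4 + sqApprox m |2 * z - 1| / 4

theorem sqApprox_bounds (m : ℕ) {z : ℝ} (h0 : 0 ≤ z) (h1 : z ≤ 1) :
    z ^ 2 ≤ sqApprox m z ∧ sqApprox m z ≤ z ∧ sqApprox m z ≤ z ^ 2 + (1 / 4) ^ m := by
  induction m generalizing z with
  | zero =>
    refine ⟨?_, le_rfl, ?_⟩ <;> simp only [sqApprox, pow_zero] <;> nlinarith
  | succ m ih =>
    have h2 : |2 * z - 1| ≤ 1 := abs_le.2 ⟨by linarith, by linarith⟩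
    obtain ⟨h3, h4, h5⟩ := ih (abs_nonneg (2 * z - 1)) h2
    rw [sq_abs] at h3 h5
    simp only [sqApprox]
    refine ⟨by nlinarith, by linarith, ?_⟩
    rw [pow_succ (1 / 4 : ℝ)]
    nlinarith

/-- The approximate product `x y ≈ ((x + y) / 2) ^ 2 - ((x - y) / 2) ^ 2`. -/
noncomputable def mulApprox (m : ℕ) (x y : ℝ) : ℝ :=
  sqApprox m |(x + y) / 2| - sqApprox m |(x - y) / 2|

theorem mulApprox_bounds (m : ℕ) {x y : ℝ} (hx : |x| ≤ 1) (hy : |y| ≤ 1) :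
    |mulApprox m x y| ≤ 1 ∧ |mulApprox m x y - x * y| ≤ (1 / 4) ^ m := by
  obtain ⟨hx1, hx2⟩ := abs_le.1 hx
  obtain ⟨hy1, hy2⟩ := abs_le.1 hy
  have ha : |(x + y) / 2| ≤ 1 := abs_le.2 ⟨by linarith, by linarith⟩
  have hb : |(x - y) / 2| ≤ 1 := abs_le.2 ⟨by linarith, by linarith⟩
  obtain ⟨a1, a2, a3⟩ := sqApprox_bounds m (abs_nonneg _) ha
  obtain ⟨b1, b2, b3⟩ := sqApprox_bounds m (abs_nonneg _) hb
  rw [sq_abs] at a1 a3 b1 b3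
  unfold mulApprox
  have ha0 := sq_nonneg ((x + y) / 2)
  have hb0 := sq_nonneg ((x - y) / 2)
  refine ⟨abs_le.2 ⟨by linarith, by linarith⟩, abs_le.2 ⟨?_, ?_⟩⟩ <;> nlinarith

/-- A plan for computing `M` monomials: the one with number `a` has degree `deg a`, it is the
variable `var a` if the degree is `1`, and the product of `left a` and `right a` if the degree is
at least `2`. Products are approximated with `m` steps, in at most `R` rounds. -/
structure MulScheme where
  M : ℕ
  mIn : ℕ
  m : ℕ
  R : ℕ
  deg : ℕ → ℕ
  var : ℕ → ℕ
  left : ℕ → ℕ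
  right : ℕ → ℕ
  M_pos : 0 < M
  mIn_pos : 0 < mIn
  deg_le : ∀ a < M, deg a ≤ 2 ^ R
  var_lt : ∀ a < M, deg a = 1 → var a < mIn
  left_lt : ∀ a < M, 2 ≤ deg a → left a < M
  right_lt : ∀ a < M, 2 ≤ deg a → right a < M
  deg_left : ∀ a < M, 2 ≤ deg a → 1 ≤ deg (left a) ∧ 2 * deg (left a) ≤ deg a + 1
  deg_right : ∀ a < M, 2 ≤ deg a → 1 ≤ deg (right a) ∧ 2 * deg (right a) ≤ deg a + 1
  deg_add : ∀ a < M, 2 ≤ deg a → deg (left a) + deg (right a) = deg a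

namespace MulScheme

variable (S : MulScheme)

/-- The number of hidden layers. -/
def H : ℕ := 1 + S.R * (S.m + 2)

/-- The last layer before the computation of monomial `a` starts. -/
def start (a : ℕ) : ℕ := 1 + (Nat.clog 2 (S.deg a) - 1) * (S.m + 2)

/-- The layer that holds the monomial `a`. -/
def out (a : ℕ) : ℕ := 1 + Nat.clog 2 (S.deg a) * (S.m + 2)

/-- The widths of the layers. -/
def width (ℓ : ℕ) : ℕ := if ℓ = 0 then S.mIn else if ℓ ≤ S.H then 6 * S.M else S.M

/-- The coefficients of the factors in half their sum (`j = 1`) and half their difference. -/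
noncomputable def half (j : ℕ) : ℝ := if j = 1 then 1 / 2 else -(1 / 2)

/-- Linear parts of the three quantities of monomial `a` that are computed in layer `ℓ + 1`. -/
noncomputable def lin (ℓ a j : ℕ) : List (ℕ × ℕ × ℝ) :=
  if S.deg a = 1 then
    if ℓ = 0 ∧ j = 0 then [(0, S.var a, 1)] else []
  else if 2 ≤ S.deg a then
    if ℓ = S.start a then
      if j = 0 then []
      else
        [(S.out (S.left a), 6 * S.left a, 1 / 2), (S.out (S.left a), 6 * S.left a + 1, -(1 / 2)),
          (S.out (S.right a), 6 * S.right a, half j),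
          (S.out (S.right a), 6 * S.right a + 1, -half j)]
    else if S.start a < ℓ ∧ ℓ ≤ S.start a + S.m + 1 then
      if j = 0 then
        [(ℓ, 6 * a, 1), (ℓ, 6 * a + 1, -1),
          (ℓ, 6 * a + 2, (1 / 4) ^ (ℓ - S.start a - 1)),
          (ℓ, 6 * a + 3, (1 / 4) ^ (ℓ - S.start a - 1)),
          (ℓ, 6 * a + 4, -(1 / 4) ^ (ℓ - S.start a - 1)),
          (ℓ, 6 * a + 5, -(1 / 4) ^ (ℓ - S.start a - 1))]
      else [(ℓ, 6 * a + 2 * j, 2), (ℓ, 6 * a + 2 * j + 1, 2)]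
    else []
  else []

/-- Constant parts of the three quantities of monomial `a` that are computed in layer `ℓ + 1`. -/
noncomputable def linBias (ℓ a j : ℕ) : ℝ :=
  if 2 ≤ S.deg a ∧ S.start a < ℓ ∧ ℓ ≤ S.start a + S.m + 1 ∧ j ≠ 0 then -1 else 0

/-- The connections of the network. -/
noncomputable def conn (ℓ k : ℕ) : List (ℕ × ℕ × ℝ) :=
  if ℓ = S.H then
    if S.deg k = 0 then [] else [(S.out k, 6 * k, 1), (S.out k, 6 * k + 1, -1)]
  else (S.lin ℓ (k / 6) (k % 6 / 2)).map fun e =>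
    (e.1, e.2.1, (if k % 2 = 0 then 1 else -1) * e.2.2)

/-- The biases of the network. -/
noncomputable def bias (ℓ k : ℕ) : ℝ :=
  if ℓ = S.H then if S.deg k = 0 then 1 else 0
  else (if k % 2 = 0 then 1 else -1) * S.linBias ℓ (k / 6) (k % 6 / 2)

theorem one_le_H : 1 ≤ S.H := Nat.le_add_right _ _

theorem width_pos (ℓ : ℕ) (_ : ℓ ≤ S.H + 1) : 0 < S.width ℓ := by
  have h1 := S.M_pos
  have h2 := S.mIn_pos
  unfold width
  split_ifs <;> omega

/-- The network of the scheme. -/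
noncomputable def net : ReLUNetwork :=
  ReLUNetwork.ofLists S.H S.one_le_H S.width S.width_pos S.conn S.bias

theorem net_inDim : S.net.inDim = S.mIn := rfl

theorem net_outDim : S.net.outDim = S.M := by
  change S.width (S.H + 1) = S.M
  simp [width]

theorem net_depth : S.net.depth = 2 + S.R * (S.m + 2) := by
  change S.H + 1 = _
  unfold H
  omega

variable {S}

theorem clog_deg_le {a : ℕ} (ha : a < S.M) : Nat.clog 2 (S.deg a) ≤ S.R :=
  Nat.clog_le_of_le_pow (S.deg_le a ha)

theorem out_le_H {a : ℕ} (ha : a < S.M) : S.out a ≤ S.H :=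
  Nat.add_le_add_left (Nat.mul_le_mul_right _ (clog_deg_le ha)) _

theorem one_le_out (a : ℕ) : 1 ≤ S.out a := Nat.le_add_right _ _

theorem out_eq_start_add {a : ℕ} (h : 2 ≤ S.deg a) : S.out a = S.start a + (S.m + 2) := by
  have h1 : 0 < Nat.clog 2 (S.deg a) := Nat.clog_pos one_lt_two h
  obtain ⟨r, hr⟩ := Nat.exists_eq_succ_of_ne_zero h1.ne'
  unfold out start
  rw [hr, Nat.succ_sub_one, Nat.succ_mul]
  omega

theorem out_le_start {a b : ℕ} (h : 2 ≤ S.deg a) (hb : 2 * S.deg b ≤ S.deg a + 1) :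
    S.out b ≤ S.start a := by
  refine Nat.add_le_add_left (Nat.mul_le_mul_right _ ?_) _
  rw [Nat.clog_of_two_le one_lt_two h, Nat.add_sub_cancel]
  exact Nat.clog_mono_right 2 (by omega)

theorem width_hidden {ℓ : ℕ} (h1 : 1 ≤ ℓ) (h2 : ℓ ≤ S.H) : S.width ℓ = 6 * S.M := by
  unfold width
  rw [if_neg (by omega), if_pos h2]

theorem lin_valid {ℓ a j : ℕ} (hℓ : ℓ < S.H) (ha : a < S.M) (hj : j < 3) :
    ∀ e ∈ S.lin ℓ a j, e.1 ≤ ℓ ∧ e.2.1 < S.width e.1 := by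
  intro e he
  unfold lin at he
  split_ifs at he with h1 h2 h3 h4 h5 h6 h7
  · rw [List.mem_singleton] at he
    subst he
    exact ⟨Nat.zero_le _, by simpa [width] using S.var_lt a ha h1⟩
  · simp at he
  · simp at he
  · have hl := S.left_lt a ha h3
    have hr := S.right_lt a ha h3
    have hl' := out_le_start h3 (S.deg_left a ha h3).2
    have hr' := out_le_start h3 (S.deg_right a ha h3).2
    have wl := width_hidden (one_le_out _) (out_le_H hl)
    have wr := width_hidden (one_le_out _) (out_le_H hr)
    simp only [List.mem_cons, List.not_mem_nil, or_false] at he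
    rcases he with rfl | rfl | rfl | rfl <;> dsimp only <;>
      (refine ⟨by omega, ?_⟩; first | rw [wl]; omega | rw [wr]; omega)
  · have w := width_hidden (S := S) (ℓ := ℓ) (by omega) hℓ.le
    simp only [List.mem_cons, List.not_mem_nil, or_false] at he
    rcases he with rfl | rfl | rfl | rfl | rfl | rfl <;> dsimp only <;>
      exact ⟨le_rfl, by rw [w]; omega⟩
  · have w := width_hidden (S := S) (ℓ := ℓ) (by omega) hℓ.le
    simp only [List.mem_cons, List.not_mem_nil, or_false] at he
    rcases he with rfl | rfl <;> dsimp only <;> exact ⟨le_rfl, by rw [w]; omega⟩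
  · simp at he
  · simp at he

/-- The affine quantity computed by the two neurons `6a + 2j`, `6a + 2j + 1` of layer `ℓ + 1`. -/
noncomputable def pre (S : MulScheme) (v : ℕ → ℕ → ℝ) (ℓ a j : ℕ) : ℝ :=
  ((S.lin ℓ a j).map fun e => e.2.2 * v e.1 e.2.1).sum + S.linBias ℓ a j

theorem sum_map_neg_weight (L : List (ℕ × ℕ × ℝ)) (v : ℕ → ℕ → ℝ) :
    ((L.map fun e => (e.1, e.2.1, -e.2.2)).map fun e => e.2.2 * v e.1 e.2.1).sum
      = -(L.map fun e => e.2.2 * v e.1 e.2.1).sum := by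
  induction L with
  | nil => simp
  | cons e L ih =>
    simp only [List.map_cons, List.sum_cons, ih]
    ring

theorem net_val_pair (y : ℕ → ℝ) {ℓ a j : ℕ} (hℓ : ℓ < S.H) (ha : a < S.M) (hj : j < 3) :
    S.net.val (fun i => y i) (ℓ + 1) (6 * a + 2 * j)
        = max (S.pre (S.net.val (fun i => y i)) ℓ a j) 0 ∧
      S.net.val (fun i => y i) (ℓ + 1) (6 * a + 2 * j + 1)
        = max (-S.pre (S.net.val (fun i => y i)) ℓ a j) 0 := by
  have w := width_hidden (S := S) (ℓ := ℓ + 1) (by omega) hℓ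
  have hval := lin_valid hℓ ha hj
  have d1 : (6 * a + 2 * j) / 6 = a := by omega
  have d2 : (6 * a + 2 * j) % 6 / 2 = j := by omega
  have d3 : (6 * a + 2 * j) % 2 = 0 := by omega
  have e1 : (6 * a + 2 * j + 1) / 6 = a := by omega
  have e2 : (6 * a + 2 * j + 1) % 6 / 2 = j := by omega
  have e3 : (6 * a + 2 * j + 1) % 2 = 1 := by omega
  have c1 : S.conn ℓ (6 * a + 2 * j) = S.lin ℓ a j := by
    rw [conn, if_neg hℓ.ne, d1, d2, d3]
    simp
  have c2 : S.conn ℓ (6 * a + 2 * j + 1)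
      = (S.lin ℓ a j).map fun e => (e.1, e.2.1, -e.2.2) := by
    rw [conn, if_neg hℓ.ne, e1, e2, e3]
    simp
  have b1 : S.bias ℓ (6 * a + 2 * j) = S.linBias ℓ a j := by
    rw [bias, if_neg hℓ.ne, d1, d2, d3]
    simp
  have b2 : S.bias ℓ (6 * a + 2 * j + 1) = -S.linBias ℓ a j := by
    rw [bias, if_neg hℓ.ne, e1, e2, e3]
    simp
  constructor
  · rw [net, ReLUNetwork.ofLists_val_succ _ (by rw [w]; omega) (by rw [c1]; exact hval), c1, b1]
    rfl
  · rw [net, ReLUNetwork.ofLists_val_succ _ (by rw [w]; omega) (by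
      rw [c2]
      intro e he
      obtain ⟨e', he', rfl⟩ := List.mem_map.1 he
      exact hval e' he'), c2, b2, pre, neg_add, sum_map_neg_weight]

theorem max_sub_max_neg (x : ℝ) : max x 0 - max (-x) 0 = x := by
  rcases le_total 0 x with h | h
  · rw [max_eq_left h, max_eq_right (by linarith), sub_zero]
  · rw [max_eq_right h, max_eq_left (by linarith)]; ring

theorem max_add_max_neg (x : ℝ) : max x 0 + max (-x) 0 = |x| := by
  rcases le_total 0 x with h | h
  · rw [max_eq_left h, max_eq_right (by linarith), add_zero, abs_of_nonneg h]
  · rw [max_eq_right h, max_eq_left (by linarith), zero_add, abs_of_nonpos h]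

theorem net_diff (y : ℕ → ℝ) {ℓ a j : ℕ} (hℓ : ℓ < S.H) (ha : a < S.M) (hj : j < 3) :
    S.net.val (fun i => y i) (ℓ + 1) (6 * a + 2 * j)
        - S.net.val (fun i => y i) (ℓ + 1) (6 * a + 2 * j + 1)
      = S.pre (S.net.val (fun i => y i)) ℓ a j := by
  rw [(net_val_pair y hℓ ha hj).1, (net_val_pair y hℓ ha hj).2, max_sub_max_neg]

theorem net_abs (y : ℕ → ℝ) {ℓ a j : ℕ} (hℓ : ℓ < S.H) (ha : a < S.M) (hj : j < 3) :
    S.net.val (fun i => y i) (ℓ + 1) (6 * a + 2 * j)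
        + S.net.val (fun i => y i) (ℓ + 1) (6 * a + 2 * j + 1)
      = |S.pre (S.net.val (fun i => y i)) ℓ a j| := by
  rw [(net_val_pair y hℓ ha hj).1, (net_val_pair y hℓ ha hj).2, max_add_max_neg]

/-- The approximate value of monomial `a` computed by the network. -/
noncomputable def approx (S : MulScheme) (y : ℕ → ℝ) (a : ℕ) : ℝ :=
  S.net.val (fun i => y i) (S.out a) (6 * a) - S.net.val (fun i => y i) (S.out a) (6 * a + 1)

theorem approx_of_deg_one (y : ℕ → ℝ) {a : ℕ} (ha : a < S.M) (h : S.deg a = 1) :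
    S.approx y a = y (S.var a) := by
  have h1 : S.out a = 0 + 1 := by simp [out, h]
  have h2 := net_diff (S := S) y (ℓ := 0) (j := 0) S.one_le_H ha (by norm_num)
  rw [approx, h1]
  refine h2.trans ?_
  have hv : S.net.val (fun i => y i) 0 (S.var a) = y (S.var a) :=
    ReLUNetwork.val_zero S.net y (by
      change S.var a < S.width 0
      simpa [width] using S.var_lt a ha h)
  simp [pre, lin, linBias, h, hv]

theorem net_invariant (y : ℕ → ℝ) {a : ℕ} (ha : a < S.M) (h : 2 ≤ S.deg a) (t : ℕ)
    (ht : t ≤ S.m) :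
    (S.net.val (fun i => y i) (S.start a + 1 + t) (6 * a + 2 * 0)
        - S.net.val (fun i => y i) (S.start a + 1 + t) (6 * a + 2 * 0 + 1))
      + (1 / 4) ^ t *
        (sqApprox (S.m - t) (S.net.val (fun i => y i) (S.start a + 1 + t) (6 * a + 2 * 1)
            + S.net.val (fun i => y i) (S.start a + 1 + t) (6 * a + 2 * 1 + 1))
          - sqApprox (S.m - t) (S.net.val (fun i => y i) (S.start a + 1 + t) (6 * a + 2 * 2)
            + S.net.val (fun i => y i) (S.start a + 1 + t) (6 * a + 2 * 2 + 1)))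
      = mulApprox S.m (S.approx y (S.left a)) (S.approx y (S.right a)) := by
  have hout := out_eq_start_add h
  have hH := out_le_H ha
  have h1 : S.deg a ≠ 1 := by omega
  induction t with
  | zero =>
    have hℓ : S.start a < S.H := by omega
    rw [add_zero, net_diff y hℓ ha (by norm_num), net_abs y hℓ ha (by norm_num),
      net_abs y hℓ ha (by norm_num)]
    have p0 : S.pre (S.net.val fun i => y i) (S.start a) a 0 = 0 := by
      simp [pre, lin, linBias, h, h1]
    have p1 : S.pre (S.net.val fun i => y i) (S.start a) a 1
        = (S.approx y (S.left a) + S.approx y (S.right a)) / 2 := by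
      simp [pre, lin, linBias, half, h, h1, approx]
      ring
    have p2 : S.pre (S.net.val fun i => y i) (S.start a) a 2
        = (S.approx y (S.left a) - S.approx y (S.right a)) / 2 := by
      simp [pre, lin, linBias, half, h, h1, approx]
      ring
    rw [p0, p1, p2, mulApprox]
    simp
  | succ t ih =>
    rw [← ih (by omega)]
    have hℓ : S.start a + 1 + t < S.H := by omega
    rw [← add_assoc, net_diff y hℓ ha (by norm_num), net_abs y hℓ ha (by norm_num),
      net_abs y hℓ ha (by norm_num)]
    have c1 : S.start a + 1 + t ≠ S.start a := by omega
    have c2 : S.start a < S.start a + 1 + t ∧ S.start a + 1 + t ≤ S.start a + S.m + 1 := by omega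
    have c3 : S.start a + 1 + t - S.start a - 1 = t := by omega
    obtain ⟨k, hk⟩ : ∃ k, S.m - t = k + 1 := ⟨S.m - t - 1, by omega⟩
    have hk' : S.m - (t + 1) = k := by omega
    rw [hk, hk']
    simp only [sqApprox]
    generalize hv : (S.net.val fun i => y i) = v
    have p0 : S.pre v (S.start a + 1 + t) a 0
        = (v (S.start a + 1 + t) (6 * a) - v (S.start a + 1 + t) (6 * a + 1))
          + (1 / 4) ^ t * ((v (S.start a + 1 + t) (6 * a + 2) + v (S.start a + 1 + t) (6 * a + 3))
            - (v (S.start a + 1 + t) (6 * a + 4) + v (S.start a + 1 + t) (6 * a + 5))) := by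
      rw [pre, lin, linBias, if_neg h1, if_pos h, if_neg c1, if_pos c2, if_pos rfl, c3,
        if_neg (by simp)]
      simp
      ring
    have p : ∀ j, j ≠ 0 → S.pre v (S.start a + 1 + t) a j
        = 2 * (v (S.start a + 1 + t) (6 * a + 2 * j)
          + v (S.start a + 1 + t) (6 * a + 2 * j + 1)) - 1 := by
      intro j hj
      rw [pre, lin, linBias, if_neg h1, if_pos h, if_neg c1, if_pos c2, if_neg hj,
        if_pos ⟨h, c2.1, c2.2, hj⟩]
      simp
      ring
    rw [p0, p 1 one_ne_zero, p 2 two_ne_zero, pow_succ]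
    simp only [mul_zero, add_zero, mul_one, Nat.reduceMul]
    ring

theorem approx_of_two_le_deg (y : ℕ → ℝ) {a : ℕ} (ha : a < S.M) (h : 2 ≤ S.deg a) :
    S.approx y a = mulApprox S.m (S.approx y (S.left a)) (S.approx y (S.right a)) := by
  have hout := out_eq_start_add h
  have hH := out_le_H ha
  have h1 : S.deg a ≠ 1 := by omega
  have hinv := net_invariant y ha h S.m le_rfl
  rw [← hinv, Nat.sub_self]
  have hℓ : S.start a + 1 + S.m < S.H := by omega
  have h2 := net_diff y (j := 0) hℓ ha (by norm_num)
  have h3 : S.out a = S.start a + 1 + S.m + 1 := by omega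
  rw [approx, h3]
  refine h2.trans ?_
  have c1 : S.start a + 1 + S.m ≠ S.start a := by omega
  have c2 : S.start a < S.start a + 1 + S.m ∧ S.start a + 1 + S.m ≤ S.start a + S.m + 1 := by omega
  have c3 : S.start a + 1 + S.m - S.start a - 1 = S.m := by omega
  simp only [sqApprox]
  rw [pre, lin, linBias, if_neg h1, if_pos h, if_neg c1, if_pos c2, if_pos rfl, c3,
    if_neg (by simp)]
  simp
  ring

/-- The scheme computes the monomials `σ_a`. -/
theorem approx_error (y : ℕ → ℝ) (hy : ∀ j, |y j| ≤ 1) (s : ℕ → ℕ →₀ ℕ)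
    (hvar : ∀ a < S.M, S.deg a = 1 → s a = Finsupp.single (S.var a) 1)
    (hmul : ∀ a < S.M, 2 ≤ S.deg a → s a = s (S.left a) + s (S.right a))
    {a : ℕ} (ha : a < S.M) (hd : 1 ≤ S.deg a) :
    |S.approx y a| ≤ 1 ∧
      |S.approx y a - sigmaWeight y (s a)| ≤ (S.deg a - 1) * (1 / 4) ^ S.m := by
  induction hn : S.deg a using Nat.strong_induction_on generalizing a with
  | _ n ih =>
    subst hn
    rcases hd.eq_or_lt with h1 | h2
    · rw [approx_of_deg_one y ha h1.symm, hvar a ha h1.symm, sigmaWeight_single, pow_one, ← h1]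
      simpa using hy _
    · have h2' : 2 ≤ S.deg a := h2
      have hl := S.deg_left a ha h2'
      have hr := S.deg_right a ha h2'
      obtain ⟨l1, l2⟩ := ih _ (by omega) (S.left_lt a ha h2') hl.1 rfl
      obtain ⟨r1, r2⟩ := ih _ (by omega) (S.right_lt a ha h2') hr.1 rfl
      obtain ⟨b1, b2⟩ := mulApprox_bounds S.m l1 r1
      rw [approx_of_two_le_deg y ha h2']
      refine ⟨b1, ?_⟩
      rw [hmul a ha h2', sigmaWeight_add, ← S.deg_add a ha h2']
      set X := S.approx y (S.left a)
      set Y := S.approx y (S.right a)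
      set p := sigmaWeight y (s (S.left a))
      set r := sigmaWeight y (s (S.right a))
      have hp : |p| ≤ 1 := abs_sigmaWeight_le_one hy _
      have e1 : |(X - p) * Y| ≤ (S.deg (S.left a) - 1) * (1 / 4) ^ S.m := by
        rw [abs_mul]
        exact (mul_le_of_le_one_right (abs_nonneg _) r1).trans l2
      have e2 : |p * (Y - r)| ≤ (S.deg (S.right a) - 1) * (1 / 4) ^ S.m := by
        rw [abs_mul]
        exact (mul_le_of_le_one_left (abs_nonneg _) hp).trans r2
      have e3 : mulApprox S.m X Y - p * r
          = (mulApprox S.m X Y - X * Y) + (X - p) * Y + p * (Y - r) := by ring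
      rw [e3]
      refine (abs_add_three _ _ _).trans ?_
      push_cast
      linarith

theorem net_realize (y : ℕ → ℝ) (k : Fin S.net.outDim) :
    S.net.realize (fun i => y i) k = if S.deg k = 0 then 1 else S.approx y k := by
  have hk : (k : ℕ) < S.M := k.2.trans_eq S.net_outDim
  have h1 : S.conn S.H k = if S.deg k = 0 then [] else
      [(S.out k, 6 * (k : ℕ), 1), (S.out k, 6 * (k : ℕ) + 1, -1)] := by
    rw [conn, if_pos rfl]
  have h2 : S.bias S.H k = if S.deg k = 0 then 1 else 0 := by
    rw [bias, if_pos rfl]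
  have w := width_hidden (one_le_out (S := S) k) (out_le_H hk)
  refine (ReLUNetwork.ofLists_realize (fun i => y i) k ?_).trans ?_
  · rw [h1]
    split_ifs
    · simp
    · intro e he
      simp only [List.mem_cons, List.not_mem_nil, or_false] at he
      rcases he with rfl | rfl <;> dsimp only <;> exact ⟨out_le_H hk, by rw [w]; omega⟩
  · rw [h1, h2]
    split_ifs
    · simp
    · simp [approx, net, sub_eq_add_neg]
      rfl

/-- In layer `ℓ + 1`, the neurons of monomial `a` have connections. -/
def Active (S : MulScheme) (ℓ a : ℕ) : Prop :=
  (S.deg a = 1 ∧ ℓ = 0) ∨ (2 ≤ S.deg a ∧ S.start a ≤ ℓ ∧ ℓ ≤ S.start a + S.m + 1)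

open Classical in
theorem lin_cost_le (ℓ a j : ℕ) :
    (S.lin ℓ a j).length + (if S.linBias ℓ a j = 0 then 0 else 1)
      ≤ if S.Active ℓ a then 6 else 0 := by
  unfold lin linBias Active
  split_ifs <;> simp_all <;> omega

theorem sum_range_six_mul (g : ℕ → ℕ) (M : ℕ) :
    ∑ k ∈ Finset.range (6 * M), g (k / 6) = 6 * ∑ a ∈ Finset.range M, g a := by
  induction M with
  | zero => simp
  | succ M ih =>
    have h : ∀ i < 6, (6 * M + i) / 6 = M := fun i hi => by omega
    have h' : ∑ i ∈ Finset.range 6, g ((6 * M + i) / 6) = 6 * g M := by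
      rw [Finset.sum_congr rfl fun i hi => congrArg g (h i (Finset.mem_range.1 hi)),
        Finset.sum_const, Finset.card_range, smul_eq_mul]
    rw [mul_add, mul_one, Finset.sum_range_add, ih, h', Finset.sum_range_succ, mul_add]

open Classical in
theorem sum_active_le (a N : ℕ) :
    ∑ ℓ ∈ Finset.range N, (if S.Active ℓ a then 6 else 0)
      ≤ if S.deg a = 0 then 0 else 6 * (S.m + 2) := by
  rw [← Finset.sum_filter, Finset.sum_const, smul_eq_mul, mul_comm]
  split_ifs with h
  · have : Finset.filter (fun ℓ => S.Active ℓ a) (Finset.range N) = ∅ :=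
      Finset.filter_eq_empty_iff.2 fun ℓ _ hA => by
        unfold Active at hA
        omega
    simp [this]
  · refine Nat.mul_le_mul_left _ ?_
    rcases eq_or_ne (S.deg a) 1 with h1 | h1
    · have hsub : Finset.filter (fun ℓ => S.Active ℓ a) (Finset.range N) ⊆ {0} := by
        intro ℓ hℓ
        have hA := (Finset.mem_filter.1 hℓ).2
        unfold Active at hA
        rw [Finset.mem_singleton]
        omega
      have := Finset.card_le_card hsub
      rw [Finset.card_singleton] at this
      omega
    · have hsub : Finset.filter (fun ℓ => S.Active ℓ a) (Finset.range N)
          ⊆ Finset.Icc (S.start a) (S.start a + S.m + 1) := by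
        intro ℓ hℓ
        have hA := (Finset.mem_filter.1 hℓ).2
        unfold Active at hA
        rw [Finset.mem_Icc]
        omega
      have := Finset.card_le_card hsub
      rw [Nat.card_Icc] at this
      omega

theorem net_size_le : S.net.size ≤ ((Finset.range S.M).filter fun a => S.deg a = 0).card
    + ((Finset.range S.M).filter fun a => S.deg a ≠ 0).card * (36 * (S.m + 2) + 2) := by
  classical
  have hhid : ∑ ℓ ∈ Finset.range S.H, ∑ k ∈ Finset.range (S.width (ℓ + 1)),
      ((S.conn ℓ k).length + if S.bias ℓ k = 0 then 0 else 1)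
      ≤ ∑ a ∈ Finset.range S.M, if S.deg a = 0 then 0 else 36 * (S.m + 2) := by
    calc _ ≤ ∑ ℓ ∈ Finset.range S.H, ∑ k ∈ Finset.range (6 * S.M),
          (if S.Active ℓ (k / 6) then 6 else 0) := by
          refine Finset.sum_le_sum fun ℓ hℓ => ?_
          have hℓ' := Finset.mem_range.1 hℓ
          rw [width_hidden (by omega) hℓ']
          refine Finset.sum_le_sum fun k _ => le_trans (le_of_eq ?_) (lin_cost_le ℓ (k / 6) (k % 6 / 2))
          rw [conn, bias, if_neg hℓ'.ne, if_neg hℓ'.ne, List.length_map]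
          congr 2
          split_ifs <;> simp
      _ = ∑ ℓ ∈ Finset.range S.H, 6 * ∑ a ∈ Finset.range S.M, (if S.Active ℓ a then 6 else 0) :=
          Finset.sum_congr rfl fun ℓ _ =>
            sum_range_six_mul (fun a => if S.Active ℓ a then 6 else 0) S.M
      _ = ∑ a ∈ Finset.range S.M, 6 * ∑ ℓ ∈ Finset.range S.H, (if S.Active ℓ a then 6 else 0) := by
          rw [← Finset.mul_sum, Finset.sum_comm, Finset.mul_sum]
      _ ≤ _ := by
          refine Finset.sum_le_sum fun a _ => ?_
          have := sum_active_le (S := S) a S.H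
          split_ifs at this ⊢ <;> omega
  have hout : ∑ k ∈ Finset.range (S.width (S.H + 1)),
      ((S.conn S.H k).length + if S.bias S.H k = 0 then 0 else 1)
      ≤ ∑ a ∈ Finset.range S.M, if S.deg a = 0 then 1 else 2 := by
    rw [show S.width (S.H + 1) = S.M by simp [width]]
    refine Finset.sum_le_sum fun a _ => ?_
    rw [conn, bias, if_pos rfl, if_pos rfl]
    split_ifs <;> simp_all
  refine ReLUNetwork.ofLists_size_le.trans ?_
  rw [Finset.sum_range_succ]
  refine (add_le_add hhid hout).trans (le_of_eq ?_)
  rw [← Finset.sum_add_distrib, Finset.card_filter, Finset.card_filter, Finset.sum_mul,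
    ← Finset.sum_add_distrib]
  refine Finset.sum_congr rfl fun a _ => ?_
  split_ifs <;> simp_all

end MulScheme

theorem Finsupp.exists_eq_single_of_degree_eq_one {s : ℕ →₀ ℕ} (hs : s.degree = 1) :
    ∃ j, s = Finsupp.single j 1 := by
  have hne : s ≠ 0 := by
    rintro rfl
    simp at hs
  obtain ⟨j, hj⟩ := Finsupp.support_nonempty_iff.2 hne
  have h1 := degree_sub_single_add_one hj
  have h2 : s - Finsupp.single j 1 = 0 := (Finsupp.degree_eq_zero_iff _).1 (by omega)
  have h3 : s - Finsupp.single j 1 + Finsupp.single j 1 = s :=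
    tsub_add_cancel_of_le
      (Finsupp.single_le_iff.2 (Nat.one_le_iff_ne_zero.2 (Finsupp.mem_support_iff.1 hj)))
  exact ⟨j, by rw [← h3, h2, zero_add]⟩

/-- The monomials with exponents in a finite downward closed set are computed up to a small error
by a network whose size is proportional to their number. -/
theorem exists_monomial_network (F : Finset (ℕ →₀ ℕ)) (hdown : ∀ s ∈ F, ∀ r ≤ s, r ∈ F)
    (h0 : 0 ∈ F) {mIn : ℕ} (hmIn : 0 < mIn) (hidx : ∀ s ∈ F, ∀ j, s j ≠ 0 → j < mIn) (m R : ℕ)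
    (hR : ∀ s ∈ F, s.degree ≤ 2 ^ R) :
    ∃ (Φ : ReLUNetwork) (idx : Fin Φ.outDim → (ℕ →₀ ℕ)), Function.Injective idx ∧
      Set.range idx = F ∧ Φ.inDim = mIn ∧ Φ.outDim = F.card ∧
      Φ.size ≤ 1 + (F.card - 1) * (36 * (m + 2) + 2) ∧ Φ.depth = 2 + R * (m + 2) ∧
      ∀ y : ℕ → ℝ, (∀ j, |y j| ≤ 1) → ∀ k,
        |Φ.realize (fun i => y i) k - sigmaWeight y (idx k)|
          ≤ (idx k).degree * (1 / 4) ^ m := by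
  classical
  set M := F.card with hM
  set s : ℕ → (ℕ →₀ ℕ) := fun a => if h : a < M then (F.equivFin.symm ⟨a, h⟩ : ℕ →₀ ℕ) else 0
    with hs
  have hsF : ∀ a < M, s a ∈ F := by
    intro a ha
    simp only [hs, dif_pos ha]
    exact (F.equivFin.symm ⟨a, ha⟩).2
  have hsurj : ∀ r ∈ F, ∃ a < M, s a = r := by
    intro r hr
    refine ⟨F.equivFin ⟨r, hr⟩, (F.equivFin ⟨r, hr⟩).2, ?_⟩
    have hlt : (F.equivFin ⟨r, hr⟩ : ℕ) < M := (F.equivFin ⟨r, hr⟩).2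
    simp only [hs, dif_pos hlt, Fin.eta, Equiv.symm_apply_apply]
  have hinj : ∀ a < M, ∀ b < M, s a = s b → a = b := by
    intro a ha b hb hab
    simp only [hs, dif_pos ha, dif_pos hb] at hab
    simpa using F.equivFin.symm.injective (Subtype.ext hab)
  have hvar : ∀ a, ∃ j, a < M → (s a).degree = 1 → s a = Finsupp.single j 1 := by
    intro a
    by_cases h : (s a).degree = 1
    · obtain ⟨j, hj⟩ := Finsupp.exists_eq_single_of_degree_eq_one h
      exact ⟨j, fun _ _ => hj⟩
    · exact ⟨0, fun _ h' => absurd h' h⟩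
  choose var hvar using hvar
  have hsplit : ∀ a, ∃ p : ℕ × ℕ, a < M → 2 ≤ (s a).degree → p.1 < M ∧ p.2 < M ∧
      s a = s p.1 + s p.2 ∧ (s p.1).degree = (s a).degree / 2 := by
    intro a
    by_cases h : a < M
    · obtain ⟨r, hr, hrd⟩ := Finsupp.exists_le_degree_eq (s a) _ (Nat.div_le_self _ 2)
      obtain ⟨l, hl, hl'⟩ := hsurj r (hdown _ (hsF a h) r hr)
      obtain ⟨l₂, hl₂, hl₂'⟩ := hsurj (s a - r) (hdown _ (hsF a h) _ tsub_le_self)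
      exact ⟨(l, l₂), fun _ _ => ⟨hl, hl₂, by rw [hl', hl₂', add_tsub_cancel_of_le hr],
        by rw [hl', hrd]⟩⟩
    · exact ⟨(0, 0), fun h' => absurd h' h⟩
  choose p hp using hsplit
  have hdegadd : ∀ a < M, 2 ≤ (s a).degree →
      (s (p a).1).degree + (s (p a).2).degree = (s a).degree := by
    intro a ha h
    conv_rhs => rw [(hp a ha h).2.2.1, map_add]
  let S : MulScheme :=
    { M := M
      mIn := mIn
      m := m
      R := R
      deg := fun a => (s a).degree
      var := var
      left := fun a => (p a).1
      right := fun a => (p a).2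
      M_pos := Finset.card_pos.2 ⟨0, h0⟩
      mIn_pos := hmIn
      deg_le := fun a ha => hR _ (hsF a ha)
      var_lt := fun a ha h => hidx _ (hsF a ha) _ (by rw [hvar a ha h]; simp)
      left_lt := fun a ha h => (hp a ha h).1
      right_lt := fun a ha h => (hp a ha h).2.1
      deg_left := fun a ha h => by
        have := (hp a ha h).2.2.2
        omega
      deg_right := fun a ha h => by
        have := (hp a ha h).2.2.2
        have := hdegadd a ha h
        omega
      deg_add := hdegadd }
  have hlt : ∀ k : Fin S.net.outDim, (k : ℕ) < M := fun k => k.2.trans_eq S.net_outDim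
  refine ⟨S.net, fun k => s k, ?_, ?_, S.net_inDim, S.net_outDim, ?_, S.net_depth, ?_⟩
  · intro k k' h
    exact Fin.ext (hinj _ (hlt k) _ (hlt k') h)
  · ext r
    constructor
    · rintro ⟨k, rfl⟩
      exact hsF _ (hlt k)
    · intro hr
      obtain ⟨a, ha, rfl⟩ := hsurj r hr
      exact ⟨⟨a, ha.trans_eq S.net_outDim.symm⟩, rfl⟩
  · refine S.net_size_le.trans ?_
    have hz : ((Finset.range S.M).filter fun a => S.deg a = 0).card = 1 := by
      obtain ⟨a, ha, ha'⟩ := hsurj 0 h0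
      rw [Finset.card_eq_one]
      refine ⟨a, ?_⟩
      ext b
      rw [Finset.mem_filter, Finset.mem_range, Finset.mem_singleton]
      constructor
      · rintro ⟨hb, hb'⟩
        exact hinj b hb a ha (((Finsupp.degree_eq_zero_iff _).1 hb').trans ha'.symm)
      · rintro rfl
        exact ⟨ha, (Finsupp.degree_eq_zero_iff _).2 ha'⟩
    have hadd : ((Finset.range S.M).filter fun a => S.deg a = 0).card
        + ((Finset.range S.M).filter fun a => S.deg a ≠ 0).card = (Finset.range S.M).card :=
      Finset.card_filter_add_card_filter_not _
    rw [hz, Finset.card_range] at hadd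
    rw [hz]
    have hM' : S.M = M := rfl
    rw [show ((Finset.range S.M).filter fun a => S.deg a ≠ 0).card = M - 1 by omega]
  · intro y hy k
    have hr := S.net_realize y k
    rw [hr]
    split_ifs with h
    · have h1 : s k = 0 := (Finsupp.degree_eq_zero_iff _).1 h
      simp [h1, sigmaWeight_zero]
    · have h1 := (MulScheme.approx_error (S := S) y hy s hvar
        (fun a ha h => (hp a ha h).2.2.1) (hlt k) (Nat.one_le_iff_ne_zero.2 h)).2
      refine h1.trans (mul_le_mul_of_nonneg_right ?_ (by positivity))
      change ((s k).degree : ℝ) - 1 ≤ (s k).degree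
      linarith

section RealEstimates

theorem half_le_log_natCast {n : ℕ} (hn : 1 < n) : 1 / 2 ≤ Real.log n := by
  have h1 : Real.log 2 ≤ Real.log n :=
    Real.log_le_log (by norm_num) (by exact_mod_cast hn)
  linarith [Real.log_two_gt_d9]

theorem one_le_div_log {n : ℕ} (hn : 1 < n) : 1 ≤ (n : ℝ) / Real.log n := by
  have h1 := half_le_log_natCast hn
  have h2 : Real.log n ≤ n - 1 :=
    Real.log_le_sub_one_of_pos (by exact_mod_cast zero_lt_one.trans hn)
  rw [one_le_div (by linarith)]
  linarith

theorem div_log_le {n : ℕ} (hn : 1 < n) : (n : ℝ) / Real.log n ≤ 2 * n := by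
  have h1 := half_le_log_natCast hn
  have h2 : (0 : ℝ) ≤ n := Nat.cast_nonneg n
  rw [div_le_iff₀ (by linarith)]
  nlinarith

theorem log_log_three_pos : 0 < Real.log (Real.log 3) := by
  refine Real.log_pos ?_
  rw [Real.lt_log_iff_exp_lt (by norm_num)]
  linarith [Real.exp_one_lt_d9]

theorem log_log_three_le {n : ℕ} (hn : 2 < n) : Real.log (Real.log 3) ≤ Real.log (Real.log n) := by
  have h3 : (0 : ℝ) < Real.log 3 := Real.log_pos (by norm_num)
  exact Real.log_le_log h3 (Real.log_le_log (by norm_num) (by exact_mod_cast hn))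

theorem log_mul_quarter_pow_le {γ A : ℝ} (hγ : 0 < γ) (hA : 0 ≤ A) {n : ℕ} (hn : 1 < n) :
    A * Real.log n * (1 / 4) ^ ⌈(γ + 1) * Real.log n⌉₊
      ≤ A * 2 ^ γ * ((n : ℝ) / Real.log n) ^ (-γ) := by
  have hn0 : (0 : ℝ) < n := by exact_mod_cast zero_lt_one.trans hn
  have hlog := half_le_log_natCast hn
  have h1 : (1 / 4 : ℝ) ^ ⌈(γ + 1) * Real.log n⌉₊ ≤ (n : ℝ) ^ (-(γ + 1)) := by
    have e1 : (1 / 4 : ℝ) ≤ Real.exp (-1) := by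
      rw [Real.exp_neg, one_div]
      exact inv_anti₀ (Real.exp_pos 1) (by linarith [Real.exp_one_lt_d9])
    calc (1 / 4 : ℝ) ^ ⌈(γ + 1) * Real.log n⌉₊ ≤ Real.exp (-1) ^ ⌈(γ + 1) * Real.log n⌉₊ :=
          pow_le_pow_left₀ (by norm_num) e1 _
      _ = Real.exp (-⌈(γ + 1) * Real.log n⌉₊) := by
          rw [← Real.exp_nat_mul]; ring_nf
      _ ≤ Real.exp (Real.log n * -(γ + 1)) := by
          refine Real.exp_le_exp.2 ?_
          have := Nat.le_ceil ((γ + 1) * Real.log n)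
          linarith
      _ = (n : ℝ) ^ (-(γ + 1)) := by rw [Real.rpow_def_of_pos hn0]
  have h2 : Real.log n ≤ n := (Real.log_le_sub_one_of_pos hn0).trans (by linarith)
  have h3 : (n : ℝ) * (n : ℝ) ^ (-(γ + 1)) = (n : ℝ) ^ (-γ) := by
    rw [← Real.rpow_one_add' hn0.le (by linarith)]
    congr 1
    ring
  have h4 : (n : ℝ) ^ (-γ) ≤ 2 ^ γ * ((n : ℝ) / Real.log n) ^ (-γ) := by
    have h5 : (2 * (n : ℝ)) ^ (-γ) ≤ ((n : ℝ) / Real.log n) ^ (-γ) :=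
      Real.rpow_le_rpow_of_nonpos (by linarith [one_le_div_log hn]) (div_log_le hn) (by linarith)
    rw [Real.mul_rpow (by norm_num) hn0.le] at h5
    have h6 : (2 : ℝ) ^ γ * 2 ^ (-γ) = 1 := by
      rw [← Real.rpow_add (by norm_num), add_neg_cancel, Real.rpow_zero]
    calc (n : ℝ) ^ (-γ) = 2 ^ γ * (2 ^ (-γ) * (n : ℝ) ^ (-γ)) := by
          rw [← mul_assoc, h6, one_mul]
      _ ≤ _ := mul_le_mul_of_nonneg_left h5 (by positivity)
  calc _ ≤ A * n * (n : ℝ) ^ (-(γ + 1)) :=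
        mul_le_mul (mul_le_mul_of_nonneg_left h2 hA) h1 (by positivity) (by positivity)
    _ = A * (n : ℝ) ^ (-γ) := by rw [mul_assoc, h3]
    _ ≤ A * (2 ^ γ * ((n : ℝ) / Real.log n) ^ (-γ)) := mul_le_mul_of_nonneg_left h4 hA
    _ = _ := by ring

theorem le_two_pow_ceil {A L : ℝ} (hA : 0 < A) (hL : 0 < L) :
    A * L ≤ 2 ^ (⌈2 * (|Real.log A| + |Real.log L|)⌉₊ + 1) := by
  set R := ⌈2 * (|Real.log A| + |Real.log L|)⌉₊ + 1 with hR
  have h1 : 2 * (|Real.log A| + |Real.log L|) ≤ R := by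
    rw [hR]
    push_cast
    linarith [Nat.le_ceil (2 * (|Real.log A| + |Real.log L|))]
  have h2 : (2 : ℝ) ^ R = Real.exp (R * Real.log 2) := by
    rw [Real.exp_nat_mul, Real.exp_log (by norm_num)]
  rw [h2, ← Real.exp_log (mul_pos hA hL), Real.log_mul hA.ne' hL.ne']
  refine Real.exp_le_exp.2 ?_
  have h3 : (R : ℝ) * (1 / 2) ≤ R * Real.log 2 :=
    mul_le_mul_of_nonneg_left (by linarith [Real.log_two_gt_d9]) (Nat.cast_nonneg _)
  linarith [le_abs_self (Real.log A), le_abs_self (Real.log L)]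

end RealEstimates

/-- Universal networks for the monomials indexed by `Λ(ξ_n)`. -/
theorem exists_network_family (q : ℝ) (hq0 : 0 < q) (hq2 : q < 2)
    (ρ : ℕ → ℝ) (hρ_one : ∀ j, 1 < ρ j) (hρ_mono : Monotone ρ)
    (hρ_sum : Summable fun j => (ρ j)⁻¹ ^ q) :
    ∃ (K C₀ c₁ c₂ A : ℝ) (ξ : ℕ → ℝ), 0 < K ∧ 0 < C₀ ∧ 0 < c₁ ∧ 0 < c₂ ∧ 0 ≤ A ∧
      ∀ n : ℕ, 1 < n → ∃ (Φ : ReLUNetwork) (idx : Fin Φ.outDim → (ℕ →₀ ℕ)),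
        (c₁ * (n / Real.log n) ≤ ξ n ∧ ξ n ≤ c₂ * (n / Real.log n) ∧
        Function.Injective idx ∧ Set.range idx = LambdaSet q ρ (ξ n) ∧
        Φ.inDim = ⌊K * (n / Real.log n)⌋₊ ∧
        Φ.outDim ≤ ⌊K * (n / Real.log n)⌋₊ ∧
        Φ.size ≤ n ∧
        3 ≤ Φ.depth ∧
        (2 < n → (Φ.depth : ℝ) ≤ C₀ * (Real.log n * Real.log (Real.log n)))) ∧
        ∀ y : ℕ → ℝ, (∀ j, |y j| ≤ 1) → ∀ k,
          |Φ.realize (fun i => y i) k - sigmaWeight y (idx k)|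
            ≤ A * ((n : ℝ) / Real.log n) ^ (-(1 / q - 1 / 2)) := by
  have hs := summable_sigmaWeight_rpow_neg hq0 hρ_one hρ_mono hρ_sum
  set Sg := ∑' s, (sigmaWeight ρ s ^ q)⁻¹ with hSg
  have hpos : ∀ s, 0 < sigmaWeight ρ s ^ q := fun s =>
    Real.rpow_pos_of_pos (sigmaWeight_pos (fun j => zero_lt_one.trans (hρ_one j)) s) q
  have hSg0 : 0 < Sg := hs.tsum_pos (fun s => (inv_pos.2 (hpos s)).le) 0 (inv_pos.2 (hpos 0))
  set γ := 1 / q - 1 / 2 with hγ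
  have hγ0 : 0 < γ := sub_pos.2 (one_div_lt_one_div_of_lt hq0 hq2)
  set Lm := q * Real.log (ρ 0) with hLm
  have hLm0 : 0 < Lm := mul_pos hq0 (Real.log_pos (hρ_one 0))
  set B := 36 * (γ + 7) + 4 with hB
  have hB0 : 0 < B := by positivity
  set c := 1 / (2 * Sg * B) with hc
  have hc0 : 0 < c := by positivity
  set c₂ := 1 + c with hc₂
  have hc₂0 : 0 < c₂ := by positivity
  set A := (2 * |Real.log (2 * c₂)| + 1) / Lm with hA
  have hA0 : 0 < A := by positivity
  set ℓ := Real.log (Real.log 3) with hℓ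
  have hℓ0 : 0 < ℓ := log_log_three_pos
  set C₀ := 2 / ℓ + ((2 * |Real.log A| + 2) / ℓ + 2) * (γ + 7) with hC₀
  refine ⟨Sg * c₂, C₀, c, c₂, A * 2 ^ γ, fun n => max 1 (c * (n / Real.log n)),
    by positivity, by positivity, hc0, hc₂0, by positivity, fun n hn => ?_⟩
  have hlog := half_le_log_natCast hn
  have hlog0 : 0 < Real.log n := by linarith
  have hn0 : (0 : ℝ) < n := by exact_mod_cast zero_lt_one.trans hn
  have hdiv := one_le_div_log hn
  set ξ := max 1 (c * (n / Real.log n)) with hξ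
  have hξ1 : 1 ≤ ξ := le_max_left _ _
  have hξ0 : 0 < ξ := by linarith
  have hξ2 : ξ ≤ c₂ * (n / Real.log n) := by
    rw [hc₂, add_mul, one_mul]
    exact max_le (le_add_of_le_of_nonneg hdiv (by positivity)) (by linarith)
  set F := (LambdaSet_finite hρ_one hs hξ0).toFinset with hF
  have hmem : ∀ s, s ∈ F ↔ s ∈ LambdaSet q ρ ξ := fun s => Set.Finite.mem_toFinset _
  have hcard : (F.card : ℝ) ≤ Sg * ξ :=
    LambdaSet_card_le hρ_one hs hξ0 fun s hsF => (hmem s).1 hsF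
  have h0F : (0 : ℕ →₀ ℕ) ∈ F := (hmem 0).2 (zero_mem_LambdaSet hξ1)
  have hcardK : F.card ≤ ⌊Sg * c₂ * (n / Real.log n)⌋₊ := by
    refine Nat.le_floor (hcard.trans ?_)
    rw [mul_assoc]
    exact mul_le_mul_of_nonneg_left hξ2 hSg0.le
  have hcard1 : 0 < F.card := Finset.card_pos.2 ⟨0, h0F⟩
  set m := ⌈(γ + 1) * Real.log n⌉₊ with hm
  have hm2 : (m : ℝ) + 2 ≤ (γ + 7) * Real.log n := by
    have := Nat.ceil_lt_add_one (show 0 ≤ (γ + 1) * Real.log n by positivity)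
    rw [← hm] at this
    nlinarith
  set R := ⌈2 * (|Real.log A| + |Real.log (Real.log n)|)⌉₊ + 1 with hR
  have hdeg : ∀ s ∈ F, (s.degree : ℝ) ≤ A * Real.log n := by
    intro s hsF
    have h1 := degree_mul_le_log hq0 hρ_one hρ_mono ((hmem s).1 hsF)
    have h2 : Real.log ξ ≤ Real.log (2 * c₂) + Real.log n := by
      rw [← Real.log_mul (by positivity) hn0.ne']
      refine Real.log_le_log hξ0 (hξ2.trans ?_)
      have := mul_le_mul_of_nonneg_left (div_log_le hn) hc₂0.le
      linarith
    rw [hA, div_mul_eq_mul_div, le_div_iff₀ hLm0]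
    have h3 := le_abs_self (Real.log (2 * c₂))
    have h4 : |Real.log (2 * c₂)| * 1 ≤ |Real.log (2 * c₂)| * (2 * Real.log n) :=
      mul_le_mul_of_nonneg_left (by linarith) (abs_nonneg _)
    linarith
  have hdegR : ∀ s ∈ F, s.degree ≤ 2 ^ R := by
    intro s hsF
    have := (hdeg s hsF).trans (le_two_pow_ceil hA0 hlog0)
    exact_mod_cast this
  obtain ⟨Φ, idx, hinj, hrange, hin, hout, hsize, hdepth, happ⟩ :=
    exists_monomial_network F
      (fun s hsF r hr => (hmem r).2 (LambdaSet_of_sigmaWeight_le hq0 hρ_one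
        (sigmaWeight_mono hρ_one hr) ((hmem s).1 hsF)))
      h0F (hcard1.trans_le hcardK)
      (fun s hsF j hj => (index_lt_card hq0 hρ_one hρ_mono hmem hsF hj).trans_le hcardK) m R hdegR
  refine ⟨Φ, idx, ⟨le_max_right _ _, hξ2, hinj, ?_, hin, hout.trans_le hcardK, ?_, ?_, ?_⟩, ?_⟩
  · rw [hrange, hF, Set.Finite.coe_toFinset]
  · refine hsize.trans ?_
    have hcost : (36 * ((m : ℝ) + 2) + 2) ≤ B * Real.log n := by
      rw [hB]
      linarith
    rcases le_or_gt (c * (n / Real.log n)) 1 with h | h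
    · have hξe : ξ = 1 := max_eq_left h
      have hF1 : F.card = 1 := Finset.card_eq_one.2 ⟨0, Finset.eq_singleton_iff_unique_mem.2
        ⟨h0F, fun s hsF => eq_zero_of_mem_LambdaSet_one hq0 hρ_one hρ_mono
          (hξe ▸ (hmem s).1 hsF)⟩⟩
      rw [hF1]
      omega
    · have hξe : ξ = c * (n / Real.log n) := max_eq_right h.le
      have h1 : ((F.card - 1 : ℕ) : ℝ) ≤ Sg * (c * (n / Real.log n)) := by
        refine le_trans ?_ (hcard.trans_eq (by rw [hξe]))
        exact_mod_cast Nat.sub_le _ _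
      have h2 : ((F.card - 1 : ℕ) : ℝ) * (36 * ((m : ℝ) + 2) + 2) ≤ n / 2 := by
        refine (mul_le_mul h1 hcost (by positivity) (by positivity)).trans (le_of_eq ?_)
        rw [hc]
        field_simp
      have h3 : (2 : ℝ) ≤ n := by exact_mod_cast hn
      have h4 : ((1 + (F.card - 1) * (36 * (m + 2) + 2) : ℕ) : ℝ) ≤ n := by
        push_cast
        linarith
      exact_mod_cast h4
  · rw [hdepth]
    have : 1 * 2 ≤ R * (m + 2) := Nat.mul_le_mul (Nat.le_add_left _ _) (Nat.le_add_left _ _)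
    omega
  · intro hn2
    have hLL := log_log_three_le hn2
    set LL := Real.log (Real.log n) with hLL'
    have hLL0 : 0 < LL := hℓ0.trans_le hLL
    have hlog1 : 1 ≤ Real.log n := by
      by_contra hlt
      exact absurd (Real.log_nonpos hlog0.le (not_le.1 hlt).le) (not_le.2 hLL0)
    have hLLℓ : 1 ≤ LL / ℓ := (one_le_div hℓ0).2 hLL
    have hRle : (R : ℝ) ≤ ((2 * |Real.log A| + 2) / ℓ + 2) * LL := by
      have h1 := Nat.ceil_lt_add_one
        (show 0 ≤ 2 * (|Real.log A| + |LL|) by positivity)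
      have h2 : (R : ℝ) ≤ 2 * (|Real.log A| + |LL|) + 2 := by
        rw [hR]
        push_cast
        linarith
      rw [abs_of_pos hLL0] at h2
      have h3 : (2 * |Real.log A| + 2) * 1 ≤ (2 * |Real.log A| + 2) * (LL / ℓ) :=
        mul_le_mul_of_nonneg_left hLLℓ (by positivity)
      have h4 : (2 * |Real.log A| + 2) * (LL / ℓ) = (2 * |Real.log A| + 2) / ℓ * LL := by ring
      linarith
    have h5 : (2 : ℝ) ≤ 2 / ℓ * (Real.log n * LL) := by
      have h6 : (2 : ℝ) * 1 ≤ 2 * (LL / ℓ) := mul_le_mul_of_nonneg_left hLLℓ (by norm_num)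
      have h7 : 2 * (LL / ℓ) * 1 ≤ 2 * (LL / ℓ) * Real.log n :=
        mul_le_mul_of_nonneg_left hlog1 (by positivity)
      calc (2 : ℝ) ≤ 2 * (LL / ℓ) * Real.log n := by linarith
        _ = _ := by ring
    have h6 : (R : ℝ) * (m + 2)
        ≤ ((2 * |Real.log A| + 2) / ℓ + 2) * LL * ((γ + 7) * Real.log n) :=
      mul_le_mul hRle hm2 (by positivity) (by positivity)
    rw [hdepth]
    push_cast
    rw [hC₀]
    linarith
  · intro y hy k
    have hk : idx k ∈ F := by
      have : idx k ∈ (F : Set (ℕ →₀ ℕ)) := hrange ▸ Set.mem_range_self k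
      exact this
    refine (happ y hy k).trans (le_trans ?_ (log_mul_quarter_pow_le hγ0 hA0.le hn))
    exact mul_le_mul_of_nonneg_right (hdeg _ hk) (by positivity)

set_option maxHeartbeats 1600000 in
theorem mainTheorem6 (q : ℝ) (hq0 : 0 < q) (hq2 : q < 2)
    (ρ : ℕ → ℝ) (hρ_one : ∀ j, 1 < ρ j) (hρ_mono : Monotone ρ)
    (hρ_sum : Summable fun j => (ρ j)⁻¹ ^ q) :
    ∃ (K C₀ c₁ c₂ : ℝ) (ξ : ℕ → ℝ) (Φ : ℕ → ReLUNetwork)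
      (idx : (n : ℕ) → Fin (Φ n).outDim → (ℕ →₀ ℕ)),
      0 < K ∧ 0 < C₀ ∧ 0 < c₁ ∧ 0 < c₂ ∧
      (∀ n : ℕ, 1 < n →
        c₁ * (n / Real.log n) ≤ ξ n ∧ ξ n ≤ c₂ * (n / Real.log n) ∧
        -- the outputs of the network are indexed by `Λ(ξ n)`
        Function.Injective (idx n) ∧ Set.range (idx n) = LambdaSet q ρ (ξ n) ∧
        (Φ n).inDim = ⌊K * (n / Real.log n)⌋₊ ∧
        (Φ n).outDim ≤ ⌊K * (n / Real.log n)⌋₊ ∧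
        (Φ n).size ≤ n ∧
        3 ≤ (Φ n).depth ∧
        (2 < n → ((Φ n).depth : ℝ) ≤ C₀ * (Real.log n * Real.log (Real.log n)))) ∧
      ∀ (d : ℕ) (D : Set (EuclideanSpace ℝ (Fin d))),
        0 < d → IsOpen D → Bornology.IsBounded D →
        ∀ (α θ : ℝ), 0 < α → θ < 1 →
        ∃ C : ℝ, 0 < C ∧
          ∀ (abar : EuclideanSpace ℝ (Fin d) → ℝ) (ψ : ℕ → EuclideanSpace ℝ (Fin d) → ℝ)
            (f : H10 D →L[ℝ] ℝ) (u : (ℕ → ℝ) → H10 D),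
            MemLp abar ∞ (volume.restrict D) →
            (∀ᵐ x ∂(volume.restrict D), α ≤ abar x) →
            (∀ j, MemLp (ψ j) ∞ (volume.restrict D)) →
            essSup (fun x => (∑' j, ENNReal.ofReal (ρ j * |ψ j x|)) / ENNReal.ofReal (abar x))
              (volume.restrict D) ≤ ENNReal.ofReal θ →
            (∀ y ∈ paramCube, IsWeakSolution (affineCoeff abar ψ y) f (u y)) →
            ∀ n : ℕ, 1 < n → ∀ y ∈ paramCube,
              ‖u y - ∑ k : Fin (Φ n).outDim,
                  (Φ n).realize (fun i => y i) k • taylorCoeff u (idx n k)‖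
                ≤ C * ‖f‖ * ((n : ℝ) / Real.log n) ^ (-(1 / q - 1 / 2)) := by

  obtain ⟨K, C₀, c₁, c₂, A, ξ, hK, hC₀, hc₁, hc₂, hA, hfam⟩ :=
    exists_network_family q hq0 hq2 ρ hρ_one hρ_mono hρ_sum
  have hs := summable_sigmaWeight_rpow_neg hq0 hρ_one hρ_mono hρ_sum
  choose Φ₀ idx₀ hΦ₀ happ₀ using hfam
  set N : ℕ → {n : ℕ // 1 < n} := fun n => if h : 1 < n then ⟨n, h⟩ else ⟨2, one_lt_two⟩ with hN
  have hNn : ∀ {n : ℕ} (h : 1 < n), N n = ⟨n, h⟩ := fun h => dif_pos h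
  refine ⟨K, C₀, c₁, c₂, ξ, fun n => Φ₀ (N n).1 (N n).2, fun n => idx₀ (N n).1 (N n).2,
    hK, hC₀, hc₁, hc₂, fun n hn => ?_, ?_⟩
  · beta_reduce
    rw [hNn hn]
    exact hΦ₀ n hn
  intro d D hd _ hDb α θ hα hθ
  obtain ⟨r, hr⟩ := hDb.exists_norm_le
  set α' := α / (4 * r ^ 2 + 1) with hα'
  have hα'0 : 0 < α' := by positivity
  set θ' := max θ 0 with hθ'
  have hθ'1 : θ' < 1 := max_lt hθ one_pos
  set Q := √(1 - θ')⁻¹ / α' * √(∑' s, (sigmaWeight ρ s ^ q)⁻¹) with hQ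
  have hQ0 : 0 ≤ Q := by positivity
  refine ⟨Q * (c₁ ^ (-(1 / q - 1 / 2)) + A) + 1, by positivity, ?_⟩
  intro abar ψ f u habar hαbar hψ hess hu n hn y hy
  beta_reduce
  rw [hNn hn]
  obtain ⟨hξ1, -, hinj, hrange, -⟩ := hΦ₀ n hn
  have happ := happ₀ n hn y hy
  set Φ := Φ₀ n hn
  set idx := idx₀ n hn
  have hx1 := one_le_div_log hn
  set x := (n : ℝ) / Real.log n with hx
  have hξ0 : 0 < ξ n := (mul_pos hc₁ (by linarith)).trans_le hξ1
  have hsum := ae_sum_le_of_essSup_le (fun j => (zero_lt_one.trans (hρ_one j)).le) hα hαbar hess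
  have hsum' : ∀ᵐ x ∂(volume.restrict D), ∀ F : Finset ℕ,
      ∑ j ∈ F, |ψ j x| ≤ θ' * abar x := by
    filter_upwards [hsum] with x hx F
    exact (Finset.sum_le_sum fun j _ =>
      le_mul_of_one_le_left (abs_nonneg _) (hρ_one j).le).trans (hx F)
  classical
  have hF : ∀ s, s ∈ Finset.univ.image idx ↔ s ∈ LambdaSet q ρ (ξ n) := by
    intro s
    rw [← hrange]
    simp
  set φ : (ℕ →₀ ℕ) → ℝ := Function.extend idx (Φ.realize fun i => y i) 0 with hφ
  have hφidx : ∀ k, φ (idx k) = Φ.realize (fun i => y i) k := fun k => hinj.extend_apply _ _ k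
  have hsol := norm_solution_sub_sum_le (V := H10 D) hq0 hq2 hρ_one hs hα'0
    (gradForm_coercive hd hr habar hα hαbar) (le_max_right θ 0) hθ'1
    (gradForm_isDominated (fun j => (zero_lt_one.trans (hρ_one j)).le) habar hψ hsum) f
    (u := u) (fun y hy w => hasSum_gradForm_of_isWeakSolution (le_max_right θ 0) habar hψ hsum' hy
      (hu y hy) w) hy hξ0 hF (φ := φ) (δ := A * x ^ (-(1 / q - 1 / 2))) (by positivity) (by
      intro s hsF
      obtain ⟨k, -, rfl⟩ := Finset.mem_image.1 hsF
      rw [hφidx]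
      exact happ k)
  rw [Finset.sum_image fun k _ k' _ h => hinj h] at hsol
  simp only [hφidx] at hsol
  refine hsol.trans ?_
  have hγ0 : 0 < 1 / q - 1 / 2 := sub_pos.2 (one_div_lt_one_div_of_lt hq0 hq2)
  have h1 : ξ n ^ (-(1 / q - 1 / 2)) ≤ c₁ ^ (-(1 / q - 1 / 2)) * x ^ (-(1 / q - 1 / 2)) := by
    rw [← Real.mul_rpow hc₁.le (by linarith)]
    exact Real.rpow_le_rpow_of_nonpos (by positivity) hξ1 (by linarith)
  have h2 : 0 ≤ ‖f‖ * x ^ (-(1 / q - 1 / 2)) := by positivity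
  calc _ = Q * ‖f‖ * (ξ n ^ (-(1 / q - 1 / 2)) + A * x ^ (-(1 / q - 1 / 2))) := by
        rw [hQ]; ring
    _ ≤ Q * ‖f‖ * (c₁ ^ (-(1 / q - 1 / 2)) * x ^ (-(1 / q - 1 / 2))
          + A * x ^ (-(1 / q - 1 / 2))) := by
        refine mul_le_mul_of_nonneg_left ?_ (by positivity)
        linarith
    _ ≤ _ := by linarith
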